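/- Let $\mathbb D=\{z\in\mathbb C:|z|<1\}$, let $dA$ be Lebesgue measure on $\mathbb D$, and put $\varphi_a(z)=\frac{a-z}{1-\overline a z}$ for $a\in\mathbb D$. For a subarc $I\subseteq\partial\mathbb D$ of positive length let $|I|\in(0,1]$ denote its arc length divided by $2\pi$, and let $$S(I)=\{z\in\mathbb D:\ 1-|I|<|z|<1,\ z/|z|\in I\}.$$ For $p>1$ and $0<s,t\le 1$, consider the following spaces of holomorphic functions $f$ on $\mathbb D$: - $\mathcal Q_t$, those with $\|f\|_{\mathcal Q_t}:=|f(0)|+\sup_{a\in\mathbb D}\left(\int_{\mathbb D}|f'(z)|^2(1-|\varphi_a(z)|^2)^t\,dA(z)\right)^{1/2}<\infty$; - $F(p,p-2,t)$, those with $\|f\|_{F(p,p-2,t)}:=|f(0)|+\sup_{a\in\mathbb D}\left(\int_{\mathbb D}|f'(z)|^p(1-|z|^2)^{p-2}(1-|\varphi_a(z)|^2)^t\,dA(z)\right)^{1/p}<\infty$; - for a positive Borel measure $\mu$ on $\mathbb D$, $\mathcal T^p_{s,p}(\mu)$, those with $\|f\|_{\mathcal T^p_{s,p}(\mu)}:=\sup_{I\subseteq\partial\mathbb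 D}\left(\frac{1}{|I|^s(\log\frac{2}{|I|})^p}\int_{S(I)}|f(z)|^p\,d\mu(z)\right)^{1/p}<\infty$. The measure $\mu$ is called a vanishing $s$-Carleson measure if $\lim_{|I|\to0}\mu(S(I))/|I|^s=0$ (uniformly over all arcs $I$ of length $|I|$). **Theorem.** Let $0<t<s\le1$ and let $\mu$ be a positive Borel measure on $\mathbb D$ that is finite on compact subsets of $\mathbb D$. Then: 1. the identity map $\mathcal Q_t\to\mathcal T^2_{s,2}(\mu)$ is (well defined and) compact if and only if $\mu$ is a vanishing $s$-Carleson measure; 2. more generally, for every $p>1$, the identity map $F(p,p-2,t)\to\mathcal T^p_{s,p}(\mu)$ is (well defined and) compact if and only if $\mu$ is a vanishing $s$-Carleson measure. Here compact means that every norm-bounded sequence in the source space has a subsequence that converges in the (semi)norm of the target space to an element of the target space. -/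

import Mathlib

open Set Filter Topology MeasureTheory
open scoped ENNReal

noncomputable section

namespace CarlesonEmbedding

/-- The open unit disc `{z : |z| < 1}`. -/
abbrev disc : Set ℂ := Metric.ball (0 : ℂ) 1

/-- The disc automorphism `φ_a(z) = (a - z) / (1 - conj a * z)`. -/
def mobius (a z : ℂ) : ℂ := (a - z) / (1 - (starRingEnd ℂ) a * z)

/-- The closed subarc of the unit circle with midpoint `e^{iθ}` and normalized length `|I| = h`
(arc length divided by `2π`), for `0 < h ≤ 1`; for `h = 1` it is the whole circle.
Every nondegenerate subarc has the same length as its closure and a smaller tent, so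
suprema and limits over all subarcs are the same as over closed ones. -/
def arc (θ h : ℝ) : Set ℂ :=
  (fun φ : ℝ => Complex.exp (φ * Complex.I)) '' Icc (θ - Real.pi * h) (θ + Real.pi * h)

/-- The Carleson tent `S(I) = {z ∈ 𝔻 : 1 - |I| < |z| < 1, z / |z| ∈ I}` over `I = arc θ h`. -/
def tent (θ h : ℝ) : Set disc :=
  {z | 1 - h < ‖(z : ℂ)‖ ∧ (z : ℂ) / (‖(z : ℂ)‖ : ℂ) ∈ arc θ h}

/-- The norm of `Q_s`,
`|f(0)| + sup_a (∫_𝔻 |f'(z)|² (1 - |φ_a(z)|²)^s dA(z))^{1/2}`, with values in `[0, ∞]`. -/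
def qNorm (s : ℝ) (f : ℂ → ℂ) : ℝ≥0∞ :=
  ‖f 0‖ₑ + ⨆ a ∈ disc,
    (∫⁻ z in disc, ‖deriv f z‖ₑ ^ (2 : ℝ) *
      ENNReal.ofReal ((1 - ‖mobius a z‖ ^ 2) ^ s)) ^ (1 / 2 : ℝ)

/-- The norm of `F(p, q, s)`,
`|f(0)| + sup_a (∫_𝔻 |f'(z)|^p (1 - |z|²)^q (1 - |φ_a(z)|²)^s dA(z))^{1/p}`,
with values in `[0, ∞]`. -/
def fNorm (p q s : ℝ) (f : ℂ → ℂ) : ℝ≥0∞ :=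
  ‖f 0‖ₑ + ⨆ a ∈ disc,
    (∫⁻ z in disc, ‖deriv f z‖ₑ ^ p *
      ENNReal.ofReal ((1 - ‖z‖ ^ 2) ^ q * (1 - ‖mobius a z‖ ^ 2) ^ s)) ^ (1 / p)

/-- The norm of `T^p_{s,p}(μ)`,
`sup_I (|I|^{-s} (log (2 / |I|))^{-p} ∫_{S(I)} |f|^p dμ)^{1/p}`, with values in `[0, ∞]`. -/
def tentNorm (p s : ℝ) (μ : Measure disc) (f : ℂ → ℂ) : ℝ≥0∞ :=
  ⨆ (θ : ℝ) (h ∈ Ioc (0 : ℝ) 1),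
    ((∫⁻ z in tent θ h, ‖f (z : ℂ)‖ₑ ^ p ∂μ) /
      ENNReal.ofReal (h ^ s * Real.log (2 / h) ^ p)) ^ (1 / p)

/-- The space of all holomorphic functions on the disc with `N f < ∞`. Functions are total on
`ℂ`; the norms above depend only on the values on the disc. -/
def holSpace (N : (ℂ → ℂ) → ℝ≥0∞) : Set (ℂ → ℂ) :=
  {f | DifferentiableOn ℂ f disc ∧ N f < ∞}

/-- `id : holSpace N₁ → holSpace N₂` is a (well defined) compact operator: every sequence that is
bounded in the first space has a subsequence that converges in the second one. -/
def IsCompactId (N₁ N₂ : (ℂ → ℂ) → ℝ≥0∞) : Prop :=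
  holSpace N₁ ⊆ holSpace N₂ ∧
  ∀ f : ℕ → ℂ → ℂ, (∀ n, f n ∈ holSpace N₁) → (∃ M : ℝ≥0∞, M < ∞ ∧ ∀ n, N₁ (f n) ≤ M) →
    ∃ g ∈ holSpace N₂, ∃ k : ℕ → ℕ, StrictMono k ∧
      Tendsto (fun n => N₂ (f (k n) - g)) atTop (𝓝 0)

/-- `μ` is a vanishing `s`-Carleson measure: `μ(S(I)) / |I|^s → 0` as `|I| → 0`, uniformly in the
position of `I`. -/
def IsVanishingCarleson (s : ℝ) (μ : Measure disc) : Prop :=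
  Tendsto (fun h : ℝ => ⨆ θ : ℝ, μ (tent θ h) / ENNReal.ofReal (h ^ s)) (𝓝[>] 0) (𝓝 0)

end CarlesonEmbedding

end

noncomputable section

namespace CarlesonEmbedding

open Metric

/-! Since $\mathcal Q_t = F(2,0,t)$, only the statement for $F(p,p-2,t)$ needs proof
(`qNorm_eq_fNorm`).

Sufficiency rests on the quantitative embedding `exists_lintegral_tent_le`: if $\mu(S(I))\le
K|I|^s$, then $\int_{S(I)}|f|^p\,d\mu \lesssim K\,|I|^s(\log\frac2{|I|})^p\|f\|^p$. For $z=r\zeta$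
in a tent of size $h$, split $f(z)$ into $f((1-h)\zeta)$ and a radial increment. Functions in
$F(p,p-2,t)$ are Bloch, so the first term is $O(\log\frac2h)$ (`exists_enorm_le_log`). The increment
is bounded by a weighted area integral of $|f'|^p$ over a nontangential region at $\zeta$, with a
gain $h^{s-t}$ (`exists_radial_increment_le`). Integrating in $\mu$ and exchanging integrals, the
Carleson condition contributes $(1-|w|)^s$. What remains is the $F(p,p-2,t)$ integral at
$a=(1-h)e^{i\theta}$ times $h^t$ (`lintegral_radialRegion_tent_le`). The condition $t<s$ is what
makes the gain positive.

Compactness follows because the bound is linear in $K$. A bounded sequence is a normal family, and a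
locally uniform limit stays in the space by Fatou. Near the circle a vanishing measure has
arbitrarily small Carleson constant; on the remaining compact disc convergence is uniform
(`tentNorm_sub_le`).

For necessity, test on $(4-\log(1-\bar az))^2/(4-\log(1-|a|))$ with $a=(1-h)e^{i\theta}$. These
functions are bounded in $F(p,p-2,t)$, tend to $0$ pointwise as $|a|\to1$, and are at least
$\frac14\log\frac2h$ on the tent of size $h$. Squaring the logarithm before normalizing gives both
the pointwise decay and the full logarithmic size. Compactness then forces their tent norms to $0$
along a subsequence, and the logarithms cancel to leave $\mu(S(I))/|I|^s\to0$. Uniform boundedness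
combines a Möbius change of variables (`norm_mul_mobiusJac_div_le`) with a Forelli-Rudin integral
(`exists_lintegral_kernel_le`). -/

/-! ### Elementary identities for disc automorphisms. -/

lemma norm_lt_one_of_mem_disc {z : ℂ} (hz : z ∈ disc) : ‖z‖ < 1 := by simpa using hz

lemma one_sub_norm_le_norm_one_sub_conj_mul {a : ℂ} (ha : ‖a‖ ≤ 1) (z : ℂ) :
    1 - ‖z‖ ≤ ‖1 - (starRingEnd ℂ) a * z‖ := by
  have h1 : ‖(1 : ℂ)‖ - ‖(starRingEnd ℂ) a * z‖ ≤ ‖1 - (starRingEnd ℂ) a * z‖ :=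
    norm_sub_norm_le _ _
  have h2 : ‖(starRingEnd ℂ) a * z‖ ≤ ‖z‖ := by
    rw [norm_mul, RCLike.norm_conj]
    exact mul_le_of_le_one_left (norm_nonneg _) ha
  rw [norm_one] at h1
  linarith

lemma one_sub_norm_le_norm_one_sub_conj_mul' {a z : ℂ} (hz : ‖z‖ ≤ 1) :
    1 - ‖a‖ ≤ ‖1 - (starRingEnd ℂ) a * z‖ := by
  have h1 : ‖(1 : ℂ)‖ - ‖(starRingEnd ℂ) a * z‖ ≤ ‖1 - (starRingEnd ℂ) a * z‖ :=
    norm_sub_norm_le _ _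
  have h2 : ‖(starRingEnd ℂ) a * z‖ ≤ ‖a‖ := by
    rw [norm_mul, RCLike.norm_conj]
    exact mul_le_of_le_one_right (norm_nonneg _) hz
  rw [norm_one] at h1
  linarith

lemma norm_one_sub_conj_mul_pos {a z : ℂ} (ha : ‖a‖ ≤ 1) (hz : ‖z‖ < 1) :
    0 < ‖1 - (starRingEnd ℂ) a * z‖ := by
  linarith [one_sub_norm_le_norm_one_sub_conj_mul ha z]

lemma norm_one_sub_conj_mul_sq (a z : ℂ) :
    ‖1 - (starRingEnd ℂ) a * z‖ ^ 2 = ‖a - z‖ ^ 2 + (1 - ‖a‖ ^ 2) * (1 - ‖z‖ ^ 2) := by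
  simp only [← Complex.normSq_eq_norm_sq, Complex.normSq_apply, Complex.sub_re, Complex.sub_im,
    Complex.mul_re, Complex.mul_im, Complex.conj_re, Complex.conj_im, Complex.one_re,
    Complex.one_im]
  ring

lemma one_sub_norm_mobius_sq {a z : ℂ} (h : 0 < ‖1 - (starRingEnd ℂ) a * z‖) :
    1 - ‖mobius a z‖ ^ 2 =
      (1 - ‖a‖ ^ 2) * (1 - ‖z‖ ^ 2) / ‖1 - (starRingEnd ℂ) a * z‖ ^ 2 := by
  rw [mobius, norm_div, div_pow, eq_div_iff (by positivity), sub_mul,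
    div_mul_cancel₀ _ (by positivity), norm_one_sub_conj_mul_sq]
  ring

/-! ### Hölder's inequality and the $L^p$ sub-mean value property. -/

lemma lintegral_mul_rpow_le {α : Type*} [MeasurableSpace α] {μ : Measure α} {p : ℝ} (hp : 1 < p)
    {f g : α → ℝ≥0∞} (hf : AEMeasurable f μ) (hg : AEMeasurable g μ) :
    (∫⁻ x, f x * g x ∂μ) ^ p ≤
      (∫⁻ x, f x ^ p ∂μ) * (∫⁻ x, g x ^ (p / (p - 1)) ∂μ) ^ (p - 1) := by
  have hpq : p.HolderConjugate (p / (p - 1)) := Real.HolderConjugate.conjExponent hp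
  have h := ENNReal.lintegral_mul_le_Lp_mul_Lq μ hpq hf hg
  have h0 : 0 < p := by linarith
  have h1 : 0 < p - 1 := by linarith
  calc (∫⁻ x, f x * g x ∂μ) ^ p
      ≤ ((∫⁻ x, f x ^ p ∂μ) ^ (1 / p) *
          (∫⁻ x, g x ^ (p / (p - 1)) ∂μ) ^ (1 / (p / (p - 1)))) ^ p := by
        gcongr
        exact h
    _ = _ := by
        rw [ENNReal.mul_rpow_of_nonneg _ _ h0.le, ← ENNReal.rpow_mul, ← ENNReal.rpow_mul]
        congr 2
        · rw [one_div, inv_mul_cancel₀ h0.ne', ENNReal.rpow_one]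
        · field_simp

lemma two_pi_mul_enorm_le_lintegral_circle {g : ℂ → ℂ} {z : ℂ} {R ρ : ℝ} (h0 : 0 < ρ) (hρ : ρ < R)
    (hg : DifferentiableOn ℂ g (ball z R)) :
    ENNReal.ofReal (2 * Real.pi) * ‖g z‖ₑ ≤
      ∫⁻ θ in Ioo (-Real.pi) Real.pi, ‖g (circleMap z ρ θ)‖ₑ := by
  have hd : DiffContOnCl ℂ g (ball z |ρ|) := by
    apply DifferentiableOn.diffContOnCl
    refine hg.mono ?_
    rw [abs_of_pos h0]
    exact closure_ball_subset_closedBall.trans (closedBall_subset_ball hρ)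
  have h1 := hd.circleAverage
  rw [Real.circleAverage] at h1
  have hper : Function.Periodic (fun θ => g (circleMap z ρ θ)) (2 * Real.pi) :=
    fun θ => by simp only [periodic_circleMap z ρ θ]
  -- The circle average lives on $(0,2\pi)$; periodicity moves it to $(-\pi,\pi)$, the angular range
  -- of polar coordinates.
  have h2 := hper.intervalIntegral_add_eq 0 (-Real.pi)
  rw [zero_add, show -Real.pi + 2 * Real.pi = Real.pi by ring] at h2
  rw [h2, intervalIntegral.integral_of_le (by linarith [Real.pi_pos]),
    integral_Ioc_eq_integral_Ioo] at h1
  rw [← h1, enorm_smul, ← mul_assoc]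
  have e : ENNReal.ofReal (2 * Real.pi) * ‖(2 * Real.pi)⁻¹‖ₑ = 1 := by
    rw [Real.enorm_of_nonneg (by positivity), ← ENNReal.ofReal_mul (by positivity),
      mul_inv_cancel₀ (by positivity), ENNReal.ofReal_one]
  rw [e, one_mul]
  exact enorm_integral_le_lintegral_enorm _

lemma lintegral_ofReal_Ioo {R : ℝ} (hR : 0 < R) :
    ∫⁻ r in Ioo 0 R, ENNReal.ofReal r = ENNReal.ofReal (R ^ 2 / 2) := by
  rw [← ofReal_integral_eq_lintegral_ofReal, ← integral_Ioc_eq_integral_Ioo,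
    ← intervalIntegral.integral_of_le hR.le, integral_id]
  · simp
  · exact (continuous_id.integrableOn_Icc).mono_set Ioo_subset_Icc_self
  · exact (ae_restrict_iff' measurableSet_Ioo).2 (ae_of_all _ fun x hx => hx.1.le)

lemma polarCoord_symm_eq_circleMap (p : ℝ × ℝ) :
    Complex.polarCoord.symm p = circleMap 0 p.1 p.2 := by
  rw [Complex.polarCoord_symm_apply, circleMap, zero_add, Complex.exp_mul_I, Complex.ofReal_cos,
    Complex.ofReal_sin]

lemma lintegral_eq_lintegral_circleMap {F : ℂ → ℝ≥0∞} (hF : Measurable F) :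
    ∫⁻ w, F w = ∫⁻ r in Ioi (0 : ℝ), ENNReal.ofReal r *
      ∫⁻ θ in Ioo (-Real.pi) Real.pi, F (circleMap 0 r θ) := by
  have hc : Continuous fun x : ℝ × ℝ => circleMap 0 x.1 x.2 := by
    unfold circleMap
    fun_prop
  rw [← Complex.lintegral_comp_polarCoord_symm, polarCoord_target, Measure.volume_eq_prod,
    setLIntegral_prod]
  · refine lintegral_congr fun r => ?_
    simp only [polarCoord_symm_eq_circleMap, smul_eq_mul]
    rw [lintegral_const_mul]
    exact hF.comp (hc.comp (by fun_prop : Continuous fun θ : ℝ => (r, θ))).measurable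
  · simp only [polarCoord_symm_eq_circleMap, smul_eq_mul]
    refine Measurable.aemeasurable ?_
    exact (measurable_fst.ennreal_ofReal).mul (hF.comp hc.measurable)

/-- Integrating the circle means over radii gives the area mean value inequality for $|g|$. Hölder
against the constant $1$ then raises it to the power $p$. -/
lemma enorm_rpow_le_lintegral_ball {g : ℂ → ℂ} {z : ℂ} {R p : ℝ} (hR : 0 < R) (hp : 1 < p)
    (hm : Measurable g) (hg : DifferentiableOn ℂ g (ball z R)) :
    ‖g z‖ₑ ^ p ≤ ENNReal.ofReal (1 / (Real.pi * R ^ 2)) * ∫⁻ w in ball z R, ‖g w‖ₑ ^ p := by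
  have hpi := Real.pi_pos
  have hA : ENNReal.ofReal (Real.pi * R ^ 2) * ‖g z‖ₑ ≤ ∫⁻ w in ball z R, ‖g w‖ₑ := by
    have e1 : ∫⁻ w in ball z R, ‖g w‖ₑ =
        ∫⁻ w, (ball (0 : ℂ) R).indicator (fun w => ‖g (z + w)‖ₑ) w := by
      rw [← lintegral_indicator measurableSet_ball, ← lintegral_add_left_eq_self _ z]
      congr 1 with w
      simp [Set.indicator]
    have hm' : Measurable fun w => ‖g (z + w)‖ₑ := (hm.comp (measurable_const_add z)).enorm
    rw [e1, lintegral_eq_lintegral_circleMap (hm'.indicator measurableSet_ball)]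
    calc ENNReal.ofReal (Real.pi * R ^ 2) * ‖g z‖ₑ
        = ∫⁻ r in Ioo 0 R, ENNReal.ofReal r * (ENNReal.ofReal (2 * Real.pi) * ‖g z‖ₑ) := by
          rw [lintegral_mul_const _ (by fun_prop), lintegral_ofReal_Ioo hR, ← mul_assoc,
            ← ENNReal.ofReal_mul (by positivity)]
          congr 2
          ring
      _ ≤ ∫⁻ r in Ioo 0 R, ENNReal.ofReal r * ∫⁻ θ in Ioo (-Real.pi) Real.pi,
            (ball (0 : ℂ) R).indicator (fun w => ‖g (z + w)‖ₑ) (circleMap 0 r θ) := by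
          refine setLIntegral_mono' measurableSet_Ioo fun r hr => ?_
          gcongr
          refine (two_pi_mul_enorm_le_lintegral_circle hr.1 hr.2 hg).trans (le_of_eq ?_)
          refine lintegral_congr fun θ => ?_
          rw [Set.indicator_of_mem]
          · simp [circleMap]
          · simpa [abs_of_pos hr.1] using hr.2
      _ ≤ _ := lintegral_mono_set Ioo_subset_Ioi_self
  have hH := lintegral_mul_rpow_le (μ := volume.restrict (ball z R)) hp
    (f := fun w => ‖g w‖ₑ) (g := fun _ => 1) hm.enorm.aemeasurable aemeasurable_const
  simp only [mul_one, ENNReal.one_rpow, lintegral_const, one_mul, Measure.restrict_apply_univ,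
    Complex.volume_ball] at hH
  set c : ℝ := Real.pi * R ^ 2 with hc
  have hc0 : 0 < c := by positivity
  have hv : ENNReal.ofReal R ^ 2 * (NNReal.pi : ℝ≥0∞) = ENNReal.ofReal c := by
    rw [hc, mul_comm, ENNReal.ofReal_mul hpi.le, ENNReal.ofReal_pow hR.le]
    congr 1
    exact (ENNReal.ofReal_coe_nnreal).symm
  rw [hv] at hH
  have h1 : ‖g z‖ₑ ≤ ENNReal.ofReal (1 / c) * ∫⁻ w in ball z R, ‖g w‖ₑ := by
    calc ‖g z‖ₑ = ENNReal.ofReal (1 / c) * (ENNReal.ofReal c * ‖g z‖ₑ) := by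
          rw [← mul_assoc, ← ENNReal.ofReal_mul (by positivity), one_div_mul_cancel hc0.ne',
            ENNReal.ofReal_one, one_mul]
      _ ≤ _ := by gcongr
  calc ‖g z‖ₑ ^ p ≤ (ENNReal.ofReal (1 / c) * ∫⁻ w in ball z R, ‖g w‖ₑ) ^ p := by gcongr
    _ ≤ ENNReal.ofReal (1 / c) ^ p *
        ((∫⁻ w in ball z R, ‖g w‖ₑ ^ p) * ENNReal.ofReal c ^ (p - 1)) := by
        rw [ENNReal.mul_rpow_of_nonneg _ _ (by linarith)]
        gcongr
    _ = _ := by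
        rw [mul_comm (∫⁻ w in ball z R, ‖g w‖ₑ ^ p), ← mul_assoc,
          ENNReal.ofReal_rpow_of_pos (by positivity), ENNReal.ofReal_rpow_of_pos hc0,
          ← ENNReal.ofReal_mul (by positivity)]
        congr 2
        rw [one_div, Real.inv_rpow hc0.le, ← Real.rpow_neg hc0.le, ← Real.rpow_add hc0,
          ← Real.rpow_neg_one]
        congr 1
        ring

/-- The two-sided comparison is needed because the exponents in use, such as $p-2$, may have either
sign. -/
lemma rpow_le_rpow_abs_mul_rpow {x y K e : ℝ} (hx : 0 < x) (hy : 0 < y) (hK : 0 < K)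
    (hxy : x ≤ K * y) (hyx : y ≤ K * x) : x ^ e ≤ K ^ |e| * y ^ e := by
  rcases le_total 0 e with he | he
  · rw [abs_of_nonneg he, ← Real.mul_rpow hK.le hy.le]
    exact Real.rpow_le_rpow hx.le hxy he
  · rw [abs_of_nonpos he, Real.rpow_neg hK.le, ← Real.inv_rpow hK.le,
      ← Real.mul_rpow (by positivity) hy.le]
    refine Real.rpow_le_rpow_of_nonpos (by positivity) ?_ he
    rw [inv_mul_le_iff₀ hK]
    exact hyx

/-! ### Pointwise growth of functions in $F(p,p-2,t)$. -/

lemma one_le_two_mul_log_two : 1 ≤ 2 * Real.log 2 := by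
  have := Real.log_two_gt_d9
  linarith

lemma enorm_zero_le_fNorm (p q t : ℝ) (f : ℂ → ℂ) : ‖f 0‖ₑ ≤ fNorm p q t f := le_self_add

lemma lintegral_le_fNorm_rpow {p q t : ℝ} (hp : 0 < p) (f : ℂ → ℂ) {a : ℂ} (ha : a ∈ disc) :
    ∫⁻ z in disc, ‖deriv f z‖ₑ ^ p *
      ENNReal.ofReal ((1 - ‖z‖ ^ 2) ^ q * (1 - ‖mobius a z‖ ^ 2) ^ t) ≤ fNorm p q t f ^ p := by
  have h : (∫⁻ z in disc, ‖deriv f z‖ₑ ^ p *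
      ENNReal.ofReal ((1 - ‖z‖ ^ 2) ^ q * (1 - ‖mobius a z‖ ^ 2) ^ t)) ^ (1 / p) ≤
      fNorm p q t f :=
    (le_iSup₂ (f := fun a (_ : a ∈ disc) => (∫⁻ z in disc, ‖deriv f z‖ₑ ^ p *
      ENNReal.ofReal ((1 - ‖z‖ ^ 2) ^ q * (1 - ‖mobius a z‖ ^ 2) ^ t)) ^ (1 / p)) a ha).trans
      le_add_self
  have h2 := ENNReal.rpow_le_rpow h hp.le
  rwa [← ENNReal.rpow_mul, one_div, inv_mul_cancel₀ hp.ne', ENNReal.rpow_one] at h2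

/-- The weight `(1 - |w|)^q ((1 - |a|)(1 - |w|) / |1 - conj a * w|²)^t`, comparable to the one
in `fNorm`. -/
def diskWeight (q t : ℝ) (a w : ℂ) : ℝ :=
  (1 - ‖w‖) ^ q * ((1 - ‖a‖) * (1 - ‖w‖) / ‖1 - (starRingEnd ℂ) a * w‖ ^ 2) ^ t

lemma diskWeight_le {q t : ℝ} (ht : 0 < t) {a w : ℂ} (ha : a ∈ disc) (hw : w ∈ disc) :
    diskWeight q t a w ≤
      2 ^ |q| * ((1 - ‖w‖ ^ 2) ^ q * (1 - ‖mobius a w‖ ^ 2) ^ t) := by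
  have ha' := norm_lt_one_of_mem_disc ha
  have hw' := norm_lt_one_of_mem_disc hw
  have hpos := norm_one_sub_conj_mul_pos ha'.le hw'
  have h1 : 0 < 1 - ‖w‖ := by linarith
  have h2 : 0 < 1 - ‖a‖ := by linarith
  have h3 : 1 - ‖w‖ ≤ 1 - ‖w‖ ^ 2 := by nlinarith [norm_nonneg w]
  have h4 : 1 - ‖a‖ ≤ 1 - ‖a‖ ^ 2 := by nlinarith [norm_nonneg a]
  rw [diskWeight, ← mul_assoc, one_sub_norm_mobius_sq hpos]
  gcongr
  · exact mul_nonneg (by positivity) (Real.rpow_nonneg (by linarith) _)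
  · apply rpow_le_rpow_abs_mul_rpow h1 (by linarith) (by norm_num)
    · linarith
    · nlinarith [norm_nonneg w]
  · linarith

lemma lintegral_diskWeight_le {p q t : ℝ} (hp : 0 < p) (ht : 0 < t) (f : ℂ → ℂ) {a : ℂ}
    (ha : a ∈ disc) :
    ∫⁻ w in disc, ‖deriv f w‖ₑ ^ p * ENNReal.ofReal (diskWeight q t a w) ≤
      ENNReal.ofReal (2 ^ |q|) * fNorm p q t f ^ p := by
  refine le_trans ?_ (mul_le_mul_right (lintegral_le_fNorm_rpow hp f ha) _)
  rw [← lintegral_const_mul' _ _ ENNReal.ofReal_ne_top]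
  refine setLIntegral_mono' measurableSet_ball fun w hw => ?_
  rw [mul_left_comm, ← ENNReal.ofReal_mul (by positivity)]
  gcongr
  exact diskWeight_le ht ha hw

lemma norm_bounds_of_mem_ball {z w : ℂ} (hw : w ∈ ball z ((1 - ‖z‖) / 2)) :
    (1 - ‖z‖) / 2 < 1 - ‖w‖ ∧ 1 - ‖w‖ < 3 * (1 - ‖z‖) / 2 := by
  rw [mem_ball, dist_eq_norm] at hw
  have h1 := norm_sub_norm_le w z
  have h2 := norm_sub_norm_le z w
  rw [norm_sub_rev] at h2
  constructor <;> linarith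

/-- The functions of `F(p, p - 2, t)` are Bloch functions. -/
lemma exists_enorm_deriv_mul_le {p t : ℝ} (hp : 1 < p) (ht : 0 < t) (ht1 : t ≤ 1) :
    ∃ C : ℝ, 0 < C ∧ ∀ f : ℂ → ℂ, DifferentiableOn ℂ f disc → ∀ z ∈ disc,
      ‖deriv f z‖ₑ * ENNReal.ofReal (1 - ‖z‖) ≤ ENNReal.ofReal C * fNorm p (p - 2) t f := by
  have hp0 : 0 < p := by linarith
  have hpi := Real.pi_pos
  set K : ℝ := 4 / Real.pi * (18 * 2 ^ |p - 2|) * 2 ^ |p - 2| with hK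
  have hK0 : 0 < K := by positivity
  refine ⟨K ^ (1 / p), by positivity, fun f hf z hz => ?_⟩
  have hz' := norm_lt_one_of_mem_disc hz
  set δ := 1 - ‖z‖ with hδ
  have hδ0 : 0 < δ := by linarith
  have hsub : ball z (δ / 2) ⊆ disc := by
    intro w hw
    have := (norm_bounds_of_mem_ball hw).1
    rw [mem_ball_zero_iff]
    linarith
  have hmean := enorm_rpow_le_lintegral_ball (half_pos hδ0) hp (measurable_deriv f)
    ((hf.deriv isOpen_ball).mono hsub)
  -- The norm is tested at $a=z$. On this ball $1-|w|\ge\delta/2$ and $|1-\bar zw|\le3\delta$, so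
  -- the Möbius factor is at least $(1/2)/9=1/18$. Its $t$-th power keeps this bound since $t\le1$.
  have hwt : ∀ w ∈ ball z (δ / 2), δ ^ (p - 2) ≤ 18 * 2 ^ |p - 2| * diskWeight (p - 2) t z w := by
    intro w hw
    obtain ⟨b1, b2⟩ := norm_bounds_of_mem_ball hw
    have hw1 : 0 < 1 - ‖w‖ := by linarith
    have e1 : δ ^ (p - 2) ≤ 2 ^ |p - 2| * (1 - ‖w‖) ^ (p - 2) :=
      rpow_le_rpow_abs_mul_rpow hδ0 hw1 (by norm_num) (by linarith) (by linarith)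
    have hden : ‖1 - (starRingEnd ℂ) z * w‖ ≤ 3 * δ := by
      have h1 := norm_one_sub_conj_mul_sq z w
      rw [mem_ball, dist_comm, dist_eq_norm] at hw
      have h2 : 1 - ‖z‖ ^ 2 ≤ 2 * δ := by rw [hδ]; nlinarith [sq_nonneg (1 - ‖z‖)]
      have h3 : 1 - ‖w‖ ^ 2 ≤ 3 * δ := by nlinarith [sq_nonneg (1 - ‖w‖)]
      have h4 : 0 ≤ 1 - ‖w‖ ^ 2 := by nlinarith [norm_nonneg w]
      have h5 : ‖z - w‖ ^ 2 ≤ (δ / 2) ^ 2 := by gcongr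
      have h6 : (1 - ‖z‖ ^ 2) * (1 - ‖w‖ ^ 2) ≤ 2 * δ * (3 * δ) := by gcongr
      exact abs_le_of_sq_le_sq' (by nlinarith) (by positivity) |>.2
    have hpos := norm_one_sub_conj_mul_pos hz'.le (by linarith : ‖w‖ < 1)
    have e2 : (1 / 18 : ℝ) ≤ (δ * (1 - ‖w‖) / ‖1 - (starRingEnd ℂ) z * w‖ ^ 2) := by
      rw [le_div_iff₀ (by positivity)]
      have : ‖1 - (starRingEnd ℂ) z * w‖ ^ 2 ≤ (3 * δ) ^ 2 := by gcongr
      nlinarith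
    have e3 : (1 / 18 : ℝ) ≤ (δ * (1 - ‖w‖) / ‖1 - (starRingEnd ℂ) z * w‖ ^ 2) ^ t :=
      calc (1 / 18 : ℝ) = (1 / 18) ^ (1 : ℝ) := (Real.rpow_one _).symm
        _ ≤ (1 / 18) ^ t :=
          Real.rpow_le_rpow_of_exponent_ge (by norm_num) (by norm_num) ht1
        _ ≤ _ := Real.rpow_le_rpow (by norm_num) e2 ht.le
    rw [diskWeight]
    calc δ ^ (p - 2) ≤ 2 ^ |p - 2| * (1 - ‖w‖) ^ (p - 2) := e1
      _ = 18 * 2 ^ |p - 2| * ((1 - ‖w‖) ^ (p - 2) * (1 / 18)) := by ring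
      _ ≤ _ := by gcongr
  have hint : ENNReal.ofReal (δ ^ (p - 2)) * ∫⁻ w in ball z (δ / 2), ‖deriv f w‖ₑ ^ p ≤
      ENNReal.ofReal (18 * 2 ^ |p - 2|) *
        (ENNReal.ofReal (2 ^ |p - 2|) * fNorm p (p - 2) t f ^ p) := by
    refine le_trans ?_ (mul_le_mul_right (lintegral_diskWeight_le hp0 ht f hz) _)
    rw [← lintegral_const_mul' _ _ ENNReal.ofReal_ne_top,
      ← lintegral_const_mul' _ _ ENNReal.ofReal_ne_top]
    refine (setLIntegral_mono' measurableSet_ball fun w hw => ?_).trans (lintegral_mono_set hsub)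
    rw [mul_left_comm, ← ENNReal.ofReal_mul (by positivity), mul_comm]
    gcongr
    exact hwt w hw
  have hfin : (‖deriv f z‖ₑ * ENNReal.ofReal δ) ^ p ≤
      ENNReal.ofReal K * fNorm p (p - 2) t f ^ p := by
    rw [ENNReal.mul_rpow_of_nonneg _ _ hp0.le, ENNReal.ofReal_rpow_of_pos hδ0]
    calc ‖deriv f z‖ₑ ^ p * ENNReal.ofReal (δ ^ p)
        ≤ (ENNReal.ofReal (1 / (Real.pi * (δ / 2) ^ 2)) *
            ∫⁻ w in ball z (δ / 2), ‖deriv f w‖ₑ ^ p) * ENNReal.ofReal (δ ^ p) := by gcongr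
      _ = ENNReal.ofReal (4 / Real.pi) * (ENNReal.ofReal (δ ^ (p - 2)) *
            ∫⁻ w in ball z (δ / 2), ‖deriv f w‖ₑ ^ p) := by
          rw [mul_right_comm, ← mul_assoc, ← ENNReal.ofReal_mul (by positivity),
            ← ENNReal.ofReal_mul (by positivity)]
          congr 2
          rw [Real.rpow_sub hδ0, Real.rpow_two]
          field_simp
          ring
      _ ≤ ENNReal.ofReal (4 / Real.pi) * (ENNReal.ofReal (18 * 2 ^ |p - 2|) *
        (ENNReal.ofReal (2 ^ |p - 2|) * fNorm p (p - 2) t f ^ p)) := by gcongr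
      _ = _ := by
          rw [← mul_assoc, ← mul_assoc, ← ENNReal.ofReal_mul (by positivity),
            ← ENNReal.ofReal_mul (by positivity)]
  have h := ENNReal.rpow_le_rpow hfin (by positivity : 0 ≤ 1 / p)
  rw [ENNReal.mul_rpow_of_nonneg _ _ (by positivity : 0 ≤ 1 / p), ← ENNReal.rpow_mul,
    ← ENNReal.rpow_mul, mul_one_div_cancel hp0.ne', ENNReal.rpow_one, ENNReal.rpow_one,
    ENNReal.ofReal_rpow_of_pos hK0] at h
  exact h

lemma ofReal_mul_mem_disc {ζ : ℂ} (hζ : ‖ζ‖ = 1) {u : ℝ} (h0 : 0 ≤ u) (h1 : u < 1) :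
    (u : ℂ) * ζ ∈ disc := by
  rw [mem_ball_zero_iff, norm_mul, hζ, mul_one, Complex.norm_real, Real.norm_of_nonneg h0]
  exact h1

/-- The increment of `f` along a radius is at most the integral of `|f'|`. -/
lemma enorm_sub_le_lintegral_radius {f : ℂ → ℂ} (hf : DifferentiableOn ℂ f disc) {ζ : ℂ}
    (hζ : ‖ζ‖ = 1) {r₀ r : ℝ} (h0 : 0 ≤ r₀) (h01 : r₀ ≤ r) (h1 : r < 1) :
    ‖f (r * ζ) - f (r₀ * ζ)‖ₑ ≤ ∫⁻ u in Ioc r₀ r, ‖deriv f (u * ζ)‖ₑ := by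
  have hmem : ∀ u ∈ uIcc r₀ r, (u : ℂ) * ζ ∈ disc := by
    intro u hu
    rw [uIcc_of_le h01] at hu
    exact ofReal_mul_mem_disc hζ (h0.trans hu.1) (hu.2.trans_lt h1)
  have hd : ∀ u ∈ uIcc r₀ r, HasDerivAt (fun u : ℝ => f (u * ζ)) (deriv f (u * ζ) * ζ) u := by
    intro u hu
    have e1 : HasDerivAt f (deriv f (u * ζ)) (u * ζ) :=
      (hf.differentiableAt (isOpen_ball.mem_nhds (hmem u hu))).hasDerivAt
    have e2 : HasDerivAt (fun u : ℝ => (u : ℂ) * ζ) ζ u := by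
      simpa using (Complex.ofRealCLM.hasDerivAt (x := u)).mul_const ζ
    exact e1.comp u e2
  have hc : ContinuousOn (fun u : ℝ => deriv f (u * ζ) * ζ) (uIcc r₀ r) := by
    refine ContinuousOn.mul ?_ continuousOn_const
    exact (hf.deriv isOpen_ball).continuousOn.comp (by fun_prop) hmem
  rw [← intervalIntegral.integral_eq_sub_of_hasDerivAt hd hc.intervalIntegrable,
    intervalIntegral.integral_of_le h01]
  refine (enorm_integral_le_lintegral_enorm _).trans (le_of_eq ?_)
  refine lintegral_congr fun u => ?_
  rw [enorm_mul, ← ofReal_norm ζ, hζ, ENNReal.ofReal_one, mul_one]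

lemma lintegral_one_div_one_sub {r : ℝ} (h0 : 0 ≤ r) (h1 : r < 1) :
    ∫⁻ u in Ioc 0 r, ENNReal.ofReal (1 / (1 - u)) = ENNReal.ofReal (Real.log (1 / (1 - r))) := by
  have hc : ContinuousOn (fun u : ℝ => 1 / (1 - u)) (uIcc 0 r) := by
    refine continuousOn_const.div (by fun_prop) fun u hu => ?_
    rw [uIcc_of_le h0] at hu
    linarith [hu.2]
  rw [← ofReal_integral_eq_lintegral_ofReal, ← intervalIntegral.integral_of_le h0]
  · have : ∫ u in (0 : ℝ)..r, 1 / (1 - u) = ∫ u in (1 - r)..1, 1 / u := by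
      rw [intervalIntegral.integral_comp_sub_left (fun u => 1 / u) 1]
      simp
    rw [this, integral_one_div_of_pos (by linarith) one_pos]
  · exact hc.intervalIntegrable.1
  · refine (ae_restrict_iff' measurableSet_Ioc).2 (ae_of_all _ fun x hx => ?_)
    have := hx.2
    exact div_nonneg zero_le_one (by linarith)

/-- The logarithmic growth of the functions of `F(p, p - 2, t)`. -/
lemma exists_enorm_le_log {p t : ℝ} (hp : 1 < p) (ht : 0 < t) (ht1 : t ≤ 1) :
    ∃ C : ℝ, 0 < C ∧ ∀ f : ℂ → ℂ, DifferentiableOn ℂ f disc → ∀ z ∈ disc,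
      ‖f z‖ₑ ≤ ENNReal.ofReal (C * Real.log (2 / (1 - ‖z‖))) * fNorm p (p - 2) t f := by
  obtain ⟨C, hC0, hC⟩ := exists_enorm_deriv_mul_le hp ht ht1
  -- $C$ comes from integrating the Bloch bound along the radius; the $2$ absorbs $|f(0)|$, as
  -- $1\le2\log2$.
  refine ⟨2 + C, by positivity, fun f hf z hz => ?_⟩
  have hz' := norm_lt_one_of_mem_disc hz
  set N := fNorm p (p - 2) t f
  set r := ‖z‖ with hr
  have hr0 : 0 ≤ r := norm_nonneg z
  obtain ⟨ζ, hζ, hzζ⟩ : ∃ ζ : ℂ, ‖ζ‖ = 1 ∧ z = r * ζ := by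
    refine ⟨Complex.exp (z.arg * Complex.I), by simp, ?_⟩
    rw [hr, Complex.norm_mul_exp_arg_mul_I]
  have h1 := enorm_sub_le_lintegral_radius hf hζ le_rfl hr0 hz'
  have h2 : ∫⁻ u in Ioc 0 r, ‖deriv f (u * ζ)‖ₑ ≤
      ENNReal.ofReal C * N * ENNReal.ofReal (Real.log (1 / (1 - r))) := by
    rw [← lintegral_one_div_one_sub hr0 hz', ← lintegral_const_mul _ (by fun_prop)]
    refine setLIntegral_mono' measurableSet_Ioc fun u hu => ?_
    have hu1 : u < 1 := hu.2.trans_lt hz'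
    have h3 := hC f hf _ (ofReal_mul_mem_disc hζ hu.1.le hu1)
    rw [norm_mul, hζ, mul_one, Complex.norm_real, Real.norm_of_nonneg hu.1.le] at h3
    calc ‖deriv f (u * ζ)‖ₑ = ‖deriv f (u * ζ)‖ₑ * ENNReal.ofReal (1 - u) *
          ENNReal.ofReal (1 / (1 - u)) := by
          rw [mul_assoc, ← ENNReal.ofReal_mul (by linarith),
            mul_one_div_cancel (by linarith), ENNReal.ofReal_one, mul_one]
      _ ≤ _ := by gcongr
  have hlog : Real.log (2 / (1 - r)) = Real.log 2 + Real.log (1 / (1 - r)) := by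
    rw [← Real.log_mul (by norm_num) (by apply ne_of_gt; apply div_pos <;> linarith),
      mul_one_div]
  have hl0 : 0 ≤ Real.log (1 / (1 - r)) := by
    apply Real.log_nonneg
    rw [le_div_iff₀ (by linarith)]
    linarith
  calc ‖f z‖ₑ = ‖f (r * ζ) - f ((0 : ℝ) * ζ) + f 0‖ₑ := by rw [hzζ]; simp
    _ ≤ ‖f (r * ζ) - f ((0 : ℝ) * ζ)‖ₑ + ‖f 0‖ₑ := enorm_add_le _ _
    _ ≤ ENNReal.ofReal C * N * ENNReal.ofReal (Real.log (1 / (1 - r))) + N :=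
        add_le_add (h1.trans h2) (enorm_zero_le_fNorm _ _ _ _)
    _ = ENNReal.ofReal (C * Real.log (1 / (1 - r)) + 1) * N := by
        rw [ENNReal.ofReal_add (by positivity) zero_le_one, ENNReal.ofReal_mul hC0.le, add_mul,
          ENNReal.ofReal_one, one_mul, mul_right_comm]
    _ ≤ _ := by
        gcongr
        rw [hlog]
        nlinarith [one_le_two_mul_log_two]

/-! ### Radial increments controlled by area integrals. -/

lemma lintegral_one_sub_rpow {h β : ℝ} (hh : 0 ≤ h) (hβ : 0 < β) :
    ∫⁻ u in Ioc (1 - h) 1, ENNReal.ofReal ((1 - u) ^ (β - 1)) = ENNReal.ofReal (h ^ β / β) := by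
  have hint : IntervalIntegrable (fun u : ℝ => (1 - u) ^ (β - 1)) volume (1 - h) 1 := by
    have := (intervalIntegral.intervalIntegrable_rpow' (a := h) (b := 0)
      (r := β - 1) (by linarith)).comp_sub_left 1
    simpa using this
  rw [← ofReal_integral_eq_lintegral_ofReal, ← intervalIntegral.integral_of_le (by linarith),
    intervalIntegral.integral_comp_sub_left (fun u => u ^ (β - 1)) 1, sub_sub_cancel, sub_self,
    integral_rpow (Or.inl (by linarith))]
  · rw [sub_add_cancel, Real.zero_rpow hβ.ne', sub_zero]
  · exact hint.1
  · refine (ae_restrict_iff' measurableSet_Ioc).2 (ae_of_all _ fun x hx => ?_)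
    exact Real.rpow_nonneg (by linarith [hx.2]) _

/-- The points `w` of the disc that contribute to the increment of a holomorphic function along
the radius of `ζ` from `(1 - h) * ζ` to `r * ζ`. -/
def radialRegion (r h : ℝ) (ζ : ℂ) : Set ℂ :=
  {w | 1 - r < 2 * (1 - ‖w‖) ∧ ‖ζ - w‖ ≤ 3 * (1 - ‖w‖) ∧ ‖ζ - w‖ < 3 * h / 2}

lemma measurableSet_radialRegion (r h : ℝ) (ζ : ℂ) : MeasurableSet (radialRegion r h ζ) := by
  simp only [radialRegion, ofPred_and]
  exact (measurableSet_lt (by fun_prop) (by fun_prop)).inter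
    ((measurableSet_le (by fun_prop) (by fun_prop)).inter
    (measurableSet_lt (by fun_prop) (by fun_prop)))

lemma radialRegion_subset_disc {r h : ℝ} (hr : r < 1) (ζ : ℂ) : radialRegion r h ζ ⊆ disc := by
  intro w hw
  rw [mem_ball_zero_iff]
  linarith [hw.1]

/-- Since $|\zeta-u\zeta|=1-u$, every $w$ in the ball satisfies $|\zeta-w|<\frac32(1-u)<3(1-|w|)$.
This explains the constants in `radialRegion`. -/
lemma mem_radialRegion_of_mem_ball {r h u : ℝ} {ζ w : ℂ} (hζ : ‖ζ‖ = 1) (h0 : 0 ≤ u)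
    (hhu : 1 - h < u) (hur : u ≤ r) (hr : r < 1) (hw : w ∈ ball ((u : ℂ) * ζ) ((1 - u) / 2)) :
    w ∈ radialRegion r h ζ ∧ (1 - u) / 2 < 1 - ‖w‖ ∧ 1 - ‖w‖ < 3 * (1 - u) / 2 := by
  have hn : ‖(u : ℂ) * ζ‖ = u := by
    rw [norm_mul, hζ, mul_one, Complex.norm_real, Real.norm_of_nonneg h0]
  have hb := norm_bounds_of_mem_ball (z := (u : ℂ) * ζ) (w := w) (by rwa [hn])
  rw [hn] at hb
  have h1 : ‖ζ - w‖ < 3 * (1 - u) / 2 := by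
    rw [mem_ball, dist_comm, dist_eq_norm] at hw
    have e : ζ - w = ((1 - u : ℝ) : ℂ) * ζ + ((u : ℂ) * ζ - w) := by push_cast; ring
    have e2 : ‖((1 - u : ℝ) : ℂ) * ζ‖ = 1 - u := by
      rw [norm_mul, hζ, mul_one, Complex.norm_real, Real.norm_of_nonneg (by linarith)]
    rw [e]
    refine (norm_add_le _ _).trans_lt ?_
    rw [e2]
    linarith
  exact ⟨⟨by linarith [hb.1], by linarith [hb.1], by linarith⟩, hb⟩

/-- A weighted Hölder inequality on the radius, the sub-mean value property at each of its points,
and Tonelli. The parameter `ε` trades the gain $h^\varepsilon$ against a more singular weight; it is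
later taken to be $s-t$. -/
lemma exists_radial_increment_le {p ε : ℝ} (hp : 1 < p) (hε : 0 < ε) :
    ∃ C : ℝ, 0 < C ∧ ∀ f : ℂ → ℂ, DifferentiableOn ℂ f disc → ∀ ζ : ℂ, ‖ζ‖ = 1 →
      ∀ h ∈ Ioc (0 : ℝ) 1, ∀ r : ℝ, 1 - h < r → r < 1 →
        ‖f (r * ζ) - f ((1 - h : ℝ) * ζ)‖ₑ ^ p ≤ ENNReal.ofReal (C * h ^ ε) *
          ∫⁻ w in radialRegion r h ζ,
            ‖deriv f w‖ₑ ^ p * ENNReal.ofReal ((1 - ‖w‖) ^ (p - 2 - ε)) := by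
  have hpi := Real.pi_pos
  have hp0 : 0 < p := by linarith
  have hp1 : 0 < p - 1 := by linarith
  set β : ℝ := ε / (p - 1) with hβ
  have hβ0 : 0 < β := by positivity
  set e : ℝ := p - 3 - ε with he
  set A : ℝ := 4 / Real.pi * 2 ^ |e| with hA
  have hA0 : 0 < A := by positivity
  refine ⟨A * 2 * (1 / β) ^ (p - 1), by positivity, fun f hf ζ hζ h hh r hr0 hr1 => ?_⟩
  have hh0 : 0 < h := hh.1
  set G : ℂ → ℝ≥0∞ := fun w => ‖deriv f w‖ₑ ^ p with hG
  have hGm : Measurable G := (measurable_deriv f).enorm.pow_const p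
  set E := radialRegion r h ζ with hE
  have hEm : MeasurableSet E := measurableSet_radialRegion r h ζ
  -- With this exponent the conjugate Hölder factor is $(1-u)^{-\alpha p/(p-1)}=(1-u)^{\beta-1}$.
  -- Its integral $h^\beta/\beta$, raised to $p-1$, gives $h^\varepsilon$.
  set α : ℝ := (p - 1 - ε) / p with hα
  have hfm : Measurable fun u : ℝ => ‖deriv f (u * ζ)‖ₑ :=
    ((measurable_deriv f).comp (by fun_prop)).enorm
  have step1 : ‖f (r * ζ) - f ((1 - h : ℝ) * ζ)‖ₑ ^ p ≤
      (∫⁻ u in Ioc (1 - h) r, G (u * ζ) * ENNReal.ofReal ((1 - u) ^ (p - 1 - ε))) *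
        ENNReal.ofReal ((1 / β) ^ (p - 1) * h ^ ε) := by
    have h1 := enorm_sub_le_lintegral_radius hf hζ (by linarith [hh.2] : 0 ≤ 1 - h) hr0.le hr1
    have h2 : ∫⁻ u in Ioc (1 - h) r, ‖deriv f (u * ζ)‖ₑ =
        ∫⁻ u in Ioc (1 - h) r, (‖deriv f (u * ζ)‖ₑ * ENNReal.ofReal ((1 - u) ^ α)) *
          ENNReal.ofReal ((1 - u) ^ (-α)) := by
      refine setLIntegral_congr_fun measurableSet_Ioc fun u hu => ?_
      have hu1 : 0 < 1 - u := by linarith [hu.2]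
      rw [mul_assoc, ← ENNReal.ofReal_mul (by positivity), ← Real.rpow_add hu1, add_neg_cancel,
        Real.rpow_zero, ENNReal.ofReal_one, mul_one]
    calc ‖f (r * ζ) - f ((1 - h : ℝ) * ζ)‖ₑ ^ p
        ≤ (∫⁻ u in Ioc (1 - h) r, (‖deriv f (u * ζ)‖ₑ * ENNReal.ofReal ((1 - u) ^ α)) *
          ENNReal.ofReal ((1 - u) ^ (-α))) ^ p := by
          rw [← h2]
          gcongr
      _ ≤ _ := lintegral_mul_rpow_le hp (by fun_prop) (by fun_prop)
      _ ≤ _ := by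
          gcongr ?_ * ?_
          · refine le_of_eq (setLIntegral_congr_fun measurableSet_Ioc fun u hu => ?_)
            have hu1 : 0 < 1 - u := by linarith [hu.2]
            simp only [hG]
            rw [ENNReal.mul_rpow_of_nonneg _ _ hp0.le, ENNReal.ofReal_rpow_of_pos (by positivity),
              ← Real.rpow_mul hu1.le, hα, div_mul_cancel₀ _ hp0.ne']
          · have h3 : ∫⁻ u in Ioc (1 - h) r, ENNReal.ofReal ((1 - u) ^ (-α)) ^ (p / (p - 1)) ≤
                ENNReal.ofReal (h ^ β / β) := by
              rw [← lintegral_one_sub_rpow hh0.le hβ0]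
              refine le_trans (le_of_eq ?_) (lintegral_mono_set (Ioc_subset_Ioc_right hr1.le))
              refine setLIntegral_congr_fun measurableSet_Ioc fun u hu => ?_
              have hu1 : 0 < 1 - u := by linarith [hu.2]
              rw [ENNReal.ofReal_rpow_of_pos (by positivity), ← Real.rpow_mul hu1.le]
              congr 2
              rw [hα, hβ]
              field_simp
              ring
            refine (ENNReal.rpow_le_rpow h3 hp1.le).trans (le_of_eq ?_)
            rw [ENNReal.ofReal_rpow_of_pos (by positivity), div_eq_mul_one_div,
              Real.mul_rpow (by positivity) (by positivity), ← Real.rpow_mul hh0.le, hβ,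
              div_mul_cancel₀ _ hp1.ne', mul_comm]
  -- Dividing by the area of the ball lowers the exponent by $2$, to `e`. The indicator records
  -- $1-u<2(1-|w|)$, the part of ball membership kept for Tonelli.
  have step2 : ∀ u ∈ Ioc (1 - h) r, G (u * ζ) * ENNReal.ofReal ((1 - u) ^ (p - 1 - ε)) ≤
      ENNReal.ofReal A * ∫⁻ w in E, (Ioo (1 - 2 * (1 - ‖w‖)) 1).indicator (fun _ =>
        G w * ENNReal.ofReal ((1 - ‖w‖) ^ e)) u := by
    intro u hu
    have hu0 : 0 ≤ u := by linarith [hu.1, hh.2]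
    have hu1 : 0 < 1 - u := by linarith [hu.2]
    have hmem : ∀ w ∈ ball ((u : ℂ) * ζ) ((1 - u) / 2), w ∈ E ∧ (1 - u) / 2 < 1 - ‖w‖ ∧
        1 - ‖w‖ < 3 * (1 - u) / 2 := fun w hw =>
      mem_radialRegion_of_mem_ball hζ hu0 hu.1 hu.2 hr1 hw
    have hmean := enorm_rpow_le_lintegral_ball (half_pos hu1) hp (measurable_deriv f)
      ((hf.deriv isOpen_ball).mono fun w hw => radialRegion_subset_disc hr1 ζ (hmem w hw).1)
    calc G (u * ζ) * ENNReal.ofReal ((1 - u) ^ (p - 1 - ε))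
        ≤ (ENNReal.ofReal (1 / (Real.pi * ((1 - u) / 2) ^ 2)) *
            ∫⁻ w in ball (u * ζ) ((1 - u) / 2), G w) * ENNReal.ofReal ((1 - u) ^ (p - 1 - ε)) := by
          gcongr
      _ = ENNReal.ofReal (4 / Real.pi) * ∫⁻ w in ball (u * ζ) ((1 - u) / 2),
            G w * ENNReal.ofReal ((1 - u) ^ e) := by
          rw [lintegral_mul_const _ hGm, mul_right_comm, ← ENNReal.ofReal_mul (by positivity),
            mul_comm (∫⁻ w in ball (u * ζ) ((1 - u) / 2), G w), ← mul_assoc,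
            ← ENNReal.ofReal_mul (by positivity)]
          congr 2
          rw [he, show p - 3 - ε = (p - 1 - ε) - 2 by ring, Real.rpow_sub hu1 _ 2, Real.rpow_two]
          field_simp
          ring
      _ ≤ ENNReal.ofReal (4 / Real.pi) * ∫⁻ w in ball (u * ζ) ((1 - u) / 2),
            ENNReal.ofReal (2 ^ |e|) * (Ioo (1 - 2 * (1 - ‖w‖)) 1).indicator (fun _ =>
              G w * ENNReal.ofReal ((1 - ‖w‖) ^ e)) u := by
          gcongr 1
          refine setLIntegral_mono' measurableSet_ball fun w hw => ?_
          obtain ⟨-, b1, b2⟩ := hmem w hw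
          rw [indicator_of_mem (by constructor <;> linarith), mul_left_comm,
            ← ENNReal.ofReal_mul (by positivity)]
          gcongr
          exact rpow_le_rpow_abs_mul_rpow hu1 (by linarith) (by norm_num) (by linarith)
            (by linarith)
      _ ≤ _ := by
          rw [lintegral_const_mul' _ _ ENNReal.ofReal_ne_top, ← mul_assoc,
            ← ENNReal.ofReal_mul (by positivity)]
          gcongr
          exact fun w hw => (hmem w hw).1
  have hjm : Measurable (Function.uncurry fun (u : ℝ) (w : ℂ) =>
      (Ioo (1 - 2 * (1 - ‖w‖)) 1).indicator (fun _ =>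
        G w * ENNReal.ofReal ((1 - ‖w‖) ^ e)) u) := by
    have : (Function.uncurry fun (u : ℝ) (w : ℂ) =>
      (Ioo (1 - 2 * (1 - ‖w‖)) 1).indicator (fun _ =>
        G w * ENNReal.ofReal ((1 - ‖w‖) ^ e)) u) =
      {x : ℝ × ℂ | 1 - 2 * (1 - ‖x.2‖) < x.1 ∧ x.1 < 1}.indicator
        (fun x => G x.2 * ENNReal.ofReal ((1 - ‖x.2‖) ^ e)) := by
      ext x
      rfl
    rw [this]
    refine Measurable.indicator ((hGm.comp measurable_snd).mul (by fun_prop)) ?_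
    simp only [ofPred_and]
    exact (measurableSet_lt (by fun_prop) (by fun_prop)).inter
      (measurableSet_lt (by fun_prop) (by fun_prop))
  -- For fixed $w$ the admissible $u$ form an interval of length $2(1-|w|)$, which raises the
  -- exponent from $p-3-\varepsilon$ to $p-2-\varepsilon$.
  have step3 : ∫⁻ u in Ioc (1 - h) r, ∫⁻ w in E, (Ioo (1 - 2 * (1 - ‖w‖)) 1).indicator (fun _ =>
        G w * ENNReal.ofReal ((1 - ‖w‖) ^ e)) u ≤
      ENNReal.ofReal 2 * ∫⁻ w in E, G w * ENNReal.ofReal ((1 - ‖w‖) ^ (p - 2 - ε)) := by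
    rw [lintegral_lintegral_swap hjm.aemeasurable, ← lintegral_const_mul' _ _ ENNReal.ofReal_ne_top]
    refine setLIntegral_mono' hEm fun w hw => ?_
    have hw1 : 0 < 1 - ‖w‖ := by linarith [hw.1]
    refine (setLIntegral_le_lintegral _ _).trans ?_
    rw [lintegral_indicator_const measurableSet_Ioo, Real.volume_Ioo, mul_assoc,
      ← ENNReal.ofReal_mul (by positivity), mul_left_comm, ← ENNReal.ofReal_mul (by positivity)]
    refine le_of_eq ?_
    congr 2
    rw [he, show p - 2 - ε = (p - 3 - ε) + 1 by ring, Real.rpow_add_one hw1.ne']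
    ring
  calc ‖f (r * ζ) - f ((1 - h : ℝ) * ζ)‖ₑ ^ p
      ≤ (∫⁻ u in Ioc (1 - h) r, G (u * ζ) * ENNReal.ofReal ((1 - u) ^ (p - 1 - ε))) *
        ENNReal.ofReal ((1 / β) ^ (p - 1) * h ^ ε) := step1
    _ ≤ (ENNReal.ofReal A * (ENNReal.ofReal 2 * ∫⁻ w in E, G w *
          ENNReal.ofReal ((1 - ‖w‖) ^ (p - 2 - ε)))) *
        ENNReal.ofReal ((1 / β) ^ (p - 1) * h ^ ε) := by
        gcongr
        refine (setLIntegral_mono' measurableSet_Ioc step2).trans ?_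
        rw [lintegral_const_mul' _ _ ENNReal.ofReal_ne_top]
        gcongr
    _ = _ := by
        rw [← mul_assoc, ← ENNReal.ofReal_mul (by positivity), mul_right_comm,
          ← ENNReal.ofReal_mul (by positivity)]
        congr 2
        ring

/-! ### Tents, Carleson bounds and the embedding. -/

lemma mem_arc_of_angle_le {θ h : ℝ} {ζ : ℂ} (hζ : ‖ζ‖ = 1)
    (hang : |(ζ / Complex.exp (θ * Complex.I)).arg| ≤ Real.pi * h) : ζ ∈ arc θ h := by
  set ψ := (ζ / Complex.exp (θ * Complex.I)).arg with hψ
  have hn : ‖ζ / Complex.exp (θ * Complex.I)‖ = 1 := by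
    rw [norm_div, hζ, Complex.norm_exp_ofReal_mul_I, div_one]
  have h1 := Complex.norm_mul_exp_arg_mul_I (ζ / Complex.exp (θ * Complex.I))
  rw [hn, Complex.ofReal_one, one_mul, ← hψ] at h1
  obtain ⟨h2, h3⟩ := abs_le.1 hang
  refine ⟨θ + ψ, ⟨by linarith, by linarith⟩, ?_⟩
  simp only
  rw [Complex.ofReal_add, add_mul, Complex.exp_add, h1,
    mul_div_cancel₀ _ (Complex.exp_ne_zero _)]

lemma norm_div_norm_of_ne_zero {z : ℂ} (hz : z ≠ 0) : ‖z / (‖z‖ : ℂ)‖ = 1 := by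
  rw [norm_div, Complex.norm_real, norm_norm, div_self (norm_ne_zero_iff.2 hz)]

/-- The tent of size $1$ is the punctured disc: the origin lies in no tent of size at most $1$. -/
lemma mem_tent_one {θ : ℝ} {z : disc} (hz : (z : ℂ) ≠ 0) : z ∈ tent θ 1 := by
  refine ⟨by simpa using hz, ?_⟩
  apply mem_arc_of_angle_le (norm_div_norm_of_ne_zero hz)
  rw [mul_one]
  exact Complex.abs_arg_le_pi _

lemma ne_zero_of_mem_tent {θ h : ℝ} (hh : h ≤ 1) {z : disc} (hz : z ∈ tent θ h) :
    (z : ℂ) ≠ 0 := by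
  have h1 := hz.1
  rw [← norm_pos_iff]
  linarith

lemma measurableSet_tent (θ h : ℝ) : MeasurableSet (tent θ h) := by
  have h1 : IsClosed (arc θ h) := by
    refine (isCompact_Icc.image ?_).isClosed
    fun_prop
  have h2 : tent θ h = {z : disc | 1 - h < ‖(z : ℂ)‖} ∩
      (fun z : disc => (z : ℂ) / (‖(z : ℂ)‖ : ℂ)) ⁻¹' arc θ h := rfl
  rw [h2]
  exact (measurableSet_lt (by fun_prop) (by fun_prop)).inter
    (h1.measurableSet.preimage (by fun_prop))

/-- `μ(S(I)) ≤ K |I|^s` for all arcs `I`. -/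
def HasCarlesonBound (s : ℝ) (μ : Measure disc) (K : ℝ≥0∞) : Prop :=
  ∀ θ : ℝ, ∀ h ∈ Ioc (0 : ℝ) 1, μ (tent θ h) ≤ K * ENNReal.ofReal (h ^ s)

lemma norm_sub_exp_le_of_mem_arc {θ h : ℝ} {ζ : ℂ} (hζ : ζ ∈ arc θ h) :
    ‖ζ - Complex.exp (θ * Complex.I)‖ ≤ Real.pi * h := by
  obtain ⟨φ, hφ, rfl⟩ := hζ
  have e : Complex.exp (φ * Complex.I) - Complex.exp (θ * Complex.I) =
      Complex.exp (θ * Complex.I) * (Complex.exp (Complex.I * (φ - θ : ℝ)) - 1) := by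
    rw [mul_sub, mul_one, ← Complex.exp_add]
    congr 2
    push_cast
    ring
  simp only
  rw [e, norm_mul, Complex.norm_exp_ofReal_mul_I, one_mul]
  refine (Real.norm_exp_I_mul_ofReal_sub_one_le).trans ?_
  rw [Real.norm_eq_abs, abs_le]
  constructor <;> linarith [hφ.1, hφ.2]

/-- The points whose radial region contains `w` lie in a tent of size comparable to `1 - |w|`. -/
lemma HasCarlesonBound.measure_radialRegion_le {s : ℝ} (hs : 0 < s) {μ : Measure disc} {K : ℝ≥0∞}
    (hK : HasCarlesonBound s μ K) {h : ℝ} (w : ℂ) (hw : w ∈ disc) :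
    μ {z : disc | (z : ℂ) ≠ 0 ∧ w ∈ radialRegion ‖(z : ℂ)‖ h ((z : ℂ) / (‖(z : ℂ)‖ : ℂ))} ≤
      K * ENNReal.ofReal ((2 * (1 - ‖w‖)) ^ s) := by
  have hw' := norm_lt_one_of_mem_disc hw
  -- If the required tent would have size at least $1$, the full tent replaces it.
  rcases le_or_gt 1 (2 * (1 - ‖w‖)) with h1 | h1
  · calc _ ≤ μ (tent 0 1) := measure_mono fun z hz => mem_tent_one hz.1
      _ ≤ K * ENNReal.ofReal (1 ^ s) := hK 0 1 ⟨one_pos, le_rfl⟩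
      _ ≤ _ := by gcongr
  · refine le_trans (measure_mono ?_) (hK w.arg (2 * (1 - ‖w‖)) ⟨by linarith, h1.le⟩)
    rintro z ⟨hz0, hz1, hz2, -⟩
    refine ⟨by linarith, ?_⟩
    set ζ : ℂ := (z : ℂ) / (‖(z : ℂ)‖ : ℂ)
    have hζ : ‖ζ‖ = 1 := norm_div_norm_of_ne_zero hz0
    apply mem_arc_of_angle_le hζ
    set η := Complex.exp (w.arg * Complex.I) with hη
    have hη1 : ‖η‖ = 1 := Complex.norm_exp_ofReal_mul_I _
    have hwη : w = ‖w‖ * η := (Complex.norm_mul_exp_arg_mul_I w).symm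
    rw [← Complex.angle_eq_abs_arg (norm_ne_zero_iff.1 (by rw [hζ]; exact one_ne_zero))
      (Complex.exp_ne_zero _)]
    refine (Complex.angle_le_mul_norm_sub hζ hη1).trans ?_
    have h2 : ‖w - η‖ = 1 - ‖w‖ := by
      have : w - η = ((‖w‖ - 1 : ℝ) : ℂ) * η := by
        conv_lhs => rw [hwη]
        push_cast
        ring
      rw [this, norm_mul, hη1, mul_one, Complex.norm_real, Real.norm_eq_abs, abs_sub_comm,
        abs_of_pos (by linarith)]
    -- An angle is at most $\pi/2$ times its chord, so $4(1-|w|)$ gives exactly the half-width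
    -- $\pi\cdot2(1-|w|)$ of the chosen arc.
    have h3 : ‖ζ - η‖ ≤ 4 * (1 - ‖w‖) := by
      have := norm_sub_le_norm_sub_add_norm_sub ζ w η
      linarith
    nlinarith [Real.pi_pos]

lemma norm_one_sub_conj_mul_le_of_near {θ h : ℝ} (hh : h ∈ Ioc (0 : ℝ) 1) {w : ℂ}
    (hw : ‖Complex.exp (θ * Complex.I) - w‖ ≤ 5 * h) :
    ‖1 - (starRingEnd ℂ) ((1 - h : ℝ) * Complex.exp (θ * Complex.I)) * w‖ ≤ 6 * h := by
  set η := Complex.exp (θ * Complex.I) with hη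
  have hη1 : ‖η‖ = 1 := Complex.norm_exp_ofReal_mul_I _
  have h1 : (starRingEnd ℂ) η * η = 1 := by
    rw [Complex.conj_mul', hη1]; simp
  have e : 1 - (starRingEnd ℂ) ((1 - h : ℝ) * η) * w =
      (h : ℂ) + ((1 - h : ℝ) : ℂ) * ((starRingEnd ℂ) η * (η - w)) := by
    rw [map_mul, Complex.conj_ofReal, mul_sub, h1]
    push_cast
    ring
  rw [e]
  refine (norm_add_le _ _).trans ?_
  rw [norm_mul, norm_mul, RCLike.norm_conj, hη1, Complex.norm_real, Complex.norm_real,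
    Real.norm_of_nonneg hh.1.le, Real.norm_of_nonneg (by linarith [hh.2]), one_mul]
  nlinarith [norm_nonneg (η - w), hh.1, hh.2]

lemma norm_ofReal_mul_exp (r θ : ℝ) (hr : 0 ≤ r) :
    ‖(r : ℂ) * Complex.exp (θ * Complex.I)‖ = r := by
  rw [norm_mul, Complex.norm_exp_ofReal_mul_I, mul_one, Complex.norm_real, Real.norm_of_nonneg hr]

/-- At $a=(1-h)e^{i\theta}$ one has $1-|a|=h$ and $|1-\bar aw|\le6h$ for $w$ near the arc. Hence
$1-|w|$ is at most $36h$ times the Möbius factor, and the $t$-th power gives the claim. -/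
lemma rpow_le_mul_diskWeight {p t θ h : ℝ} (ht : 0 < t) (hh : h ∈ Ioc (0 : ℝ) 1) {w : ℂ}
    (hw1 : w ∈ disc) (hw : ‖Complex.exp (θ * Complex.I) - w‖ ≤ 5 * h) :
    (1 - ‖w‖) ^ (p - 2 + t) ≤ 36 ^ t * h ^ t *
      diskWeight (p - 2) t ((1 - h : ℝ) * Complex.exp (θ * Complex.I)) w := by
  have hw' : 0 < 1 - ‖w‖ := by linarith [norm_lt_one_of_mem_disc hw1]
  have h0 := hh.1
  have hn := norm_ofReal_mul_exp (1 - h) θ (by linarith [hh.2])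
  have h6 := norm_one_sub_conj_mul_le_of_near hh hw
  set a := ((1 - h : ℝ) : ℂ) * Complex.exp (θ * Complex.I) with ha
  have hpos : 0 < ‖1 - (starRingEnd ℂ) a * w‖ :=
    norm_one_sub_conj_mul_pos (by rw [hn]; linarith) (by linarith)
  rw [diskWeight, hn, sub_sub_cancel, mul_left_comm, ← Real.mul_rpow (by norm_num) h0.le,
    ← Real.mul_rpow (by positivity) (by positivity), Real.rpow_add hw']
  gcongr
  rw [mul_div_assoc', le_div_iff₀ (by positivity)]
  have : ‖1 - (starRingEnd ℂ) a * w‖ ^ 2 ≤ (6 * h) ^ 2 := by gcongr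
  calc (1 - ‖w‖) * ‖1 - (starRingEnd ℂ) a * w‖ ^ 2 ≤ (1 - ‖w‖) * (6 * h) ^ 2 := by gcongr
    _ = _ := by ring

/-- After Tonelli, each $w$ carries the measure of those $z$ whose region contains it, at most
$K(2(1-|w|))^s$. The exponent becomes $p-2-(s-t)+s=p-2+t$, matching `rpow_le_mul_diskWeight`. -/
lemma lintegral_radialRegion_tent_le {p t s : ℝ} (hp : 1 < p) (ht : 0 < t) (hts : t < s)
    {μ : Measure disc} [SFinite μ] {K : ℝ≥0∞} (hK : HasCarlesonBound s μ K) (f : ℂ → ℂ)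
    {θ h : ℝ} (hh : h ∈ Ioc (0 : ℝ) 1) :
    ∫⁻ z in tent θ h, (∫⁻ w in radialRegion ‖(z : ℂ)‖ h ((z : ℂ) / (‖(z : ℂ)‖ : ℂ)),
        ‖deriv f w‖ₑ ^ p * ENNReal.ofReal ((1 - ‖w‖) ^ (p - 2 - (s - t)))) ∂μ ≤
      K * ENNReal.ofReal (2 ^ s * (36 ^ t * h ^ t)) *
        (ENNReal.ofReal (2 ^ |p - 2|) * fNorm p (p - 2) t f ^ p) := by
  have hs0 : 0 < s := ht.trans hts
  have hh0 : 0 < h := hh.1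
  set H : ℂ → ℝ≥0∞ :=
    fun w => ‖deriv f w‖ₑ ^ p * ENNReal.ofReal ((1 - ‖w‖) ^ (p - 2 - (s - t))) with hH
  have hHm : Measurable H := ((measurable_deriv f).enorm.pow_const p).mul (by fun_prop)
  set η := Complex.exp (θ * Complex.I)
  set a : ℂ := (1 - h : ℝ) * η with ha
  have ham : a ∈ disc := by
    rw [mem_ball_zero_iff, norm_ofReal_mul_exp _ _ (by linarith [hh.2])]
    linarith
  set T : Set (disc × ℂ) :=
    {x | x.2 ∈ radialRegion ‖(x.1 : ℂ)‖ h ((x.1 : ℂ) / (‖(x.1 : ℂ)‖ : ℂ))} with hT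
  have hTm : MeasurableSet T := by
    simp only [hT, radialRegion, ofPred_and]
    exact (measurableSet_lt (by fun_prop) (by fun_prop)).inter
      ((measurableSet_le (by fun_prop) (by fun_prop)).inter
      (measurableSet_lt (by fun_prop) (by fun_prop)))
  have hjm : Measurable (Function.uncurry fun (z : disc) (w : ℂ) =>
      T.indicator (fun x => H x.2) (z, w)) := by
    have : Measurable (T.indicator fun x => H x.2) := (hHm.comp measurable_snd).indicator hTm
    exact this
  have e1 : ∀ z ∈ tent θ h, (∫⁻ w in radialRegion ‖(z : ℂ)‖ h ((z : ℂ) / (‖(z : ℂ)‖ : ℂ)), H w) =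
      ∫⁻ w in disc, T.indicator (fun x => H x.2) (z, w) := by
    intro z hz
    have e2 : ∀ w, T.indicator (fun x => H x.2) (z, w) =
        (radialRegion ‖(z : ℂ)‖ h ((z : ℂ) / (‖(z : ℂ)‖ : ℂ))).indicator H w := fun w => rfl
    simp_rw [e2]
    rw [setLIntegral_indicator (measurableSet_radialRegion _ _ _),
      inter_eq_self_of_subset_left (radialRegion_subset_disc (norm_lt_one_of_mem_disc z.2) _)]
  rw [setLIntegral_congr_fun (measurableSet_tent θ h) e1,
    lintegral_lintegral_swap hjm.aemeasurable]
  refine le_trans ?_ (mul_le_mul_right (lintegral_diskWeight_le (by linarith : 0 < p) ht f ham) _)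
  have hDm : Measurable fun w => ‖deriv f w‖ₑ ^ p *
      ENNReal.ofReal (diskWeight (p - 2) t a w) := by
    refine ((measurable_deriv f).enorm.pow_const p).mul ?_
    unfold diskWeight
    fun_prop
  rw [← lintegral_const_mul _ hDm]
  refine setLIntegral_mono' measurableSet_ball fun w hw => ?_
  have hw' : 0 < 1 - ‖w‖ := by linarith [norm_lt_one_of_mem_disc hw]
  set S : Set disc :=
    {z | w ∈ radialRegion ‖(z : ℂ)‖ h ((z : ℂ) / (‖(z : ℂ)‖ : ℂ))} with hS
  have hSm : MeasurableSet S := hTm.preimage (by fun_prop : Measurable fun z : disc => (z, w))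
  have e3 : ∫⁻ z in tent θ h, T.indicator (fun x => H x.2) (z, w) ∂μ = H w * μ (S ∩ tent θ h) := by
    have : ∀ z : disc, T.indicator (fun x => H x.2) (z, w) = S.indicator (fun _ => H w) z :=
      fun z => rfl
    simp_rw [this]
    rw [lintegral_indicator_const hSm, Measure.restrict_apply hSm]
  rw [e3]
  rcases (S ∩ tent θ h).eq_empty_or_nonempty with hemp | ⟨z, hz1, hz2⟩
  · simp [hemp]
  -- The arc contributes at most $\pi h$ and the region at most $\frac32h$.
  have hnear : ‖η - w‖ ≤ 5 * h := by
    have h1 := norm_sub_exp_le_of_mem_arc hz2.2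
    have h2 := hz1.2.2
    have h3 := norm_sub_le_norm_sub_add_norm_sub η ((z : ℂ) / (‖(z : ℂ)‖ : ℂ)) w
    rw [norm_sub_rev η ((z : ℂ) / (‖(z : ℂ)‖ : ℂ))] at h3
    nlinarith [Real.pi_lt_d2]
  have hmeas : μ (S ∩ tent θ h) ≤ K * ENNReal.ofReal ((2 * (1 - ‖w‖)) ^ s) :=
    le_trans (measure_mono fun z hz => And.intro (ne_zero_of_mem_tent hh.2 hz.2) hz.1)
      (hK.measure_radialRegion_le hs0 w hw (h := h))
  have hwt := rpow_le_mul_diskWeight (p := p) ht hh hw hnear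
  calc H w * μ (S ∩ tent θ h) ≤ H w * (K * ENNReal.ofReal ((2 * (1 - ‖w‖)) ^ s)) := by gcongr
    _ = K * (‖deriv f w‖ₑ ^ p * ENNReal.ofReal (2 ^ s * (1 - ‖w‖) ^ (p - 2 + t))) := by
        rw [hH, mul_left_comm, mul_assoc, ← ENNReal.ofReal_mul (by positivity)]
        congr 3
        rw [Real.mul_rpow (by norm_num) hw'.le, mul_left_comm, ← Real.rpow_add hw']
        congr 2
        ring
    _ ≤ K * (‖deriv f w‖ₑ ^ p * ENNReal.ofReal (2 ^ s * (36 ^ t * h ^ t *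
          diskWeight (p - 2) t a w))) := by gcongr
    _ = _ := by
        rw [← mul_assoc (2 ^ s : ℝ), ENNReal.ofReal_mul (p := 2 ^ s * (36 ^ t * h ^ t))
          (by positivity)]
        ring

/-- The embedding of `F(p, p - 2, t)` into the tent space of an `s`-Carleson measure, `t < s`. -/
lemma exists_lintegral_tent_le {p t s : ℝ} (hp : 1 < p) (ht : 0 < t) (hts : t < s) (hs : s ≤ 1) :
    ∃ C : ℝ, 0 < C ∧ ∀ (μ : Measure disc) [SFinite μ] (K : ℝ≥0∞), HasCarlesonBound s μ K →
      ∀ f : ℂ → ℂ, DifferentiableOn ℂ f disc → ∀ θ : ℝ, ∀ h ∈ Ioc (0 : ℝ) 1,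
        ∫⁻ z in tent θ h, ‖f (z : ℂ)‖ₑ ^ p ∂μ ≤ ENNReal.ofReal (C * (h ^ s * Real.log (2 / h) ^ p)) *
          (K * fNorm p (p - 2) t f ^ p) := by
  have hp0 : 0 < p := by linarith
  obtain ⟨C₁, hC₁, hlog⟩ := exists_enorm_le_log hp ht (by linarith : t ≤ 1)
  obtain ⟨C₂, hC₂, hinc⟩ := exists_radial_increment_le hp (sub_pos.2 hts)
  set B : ℝ := C₂ * (2 ^ s * 36 ^ t * 2 ^ |p - 2|) with hB
  have hB0 : 0 < B := by positivity
  refine ⟨2 ^ (p - 1) * (C₁ ^ p + B * 2 ^ p), by positivity, fun μ _ K hK f hf θ h hh => ?_⟩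
  have hh0 : 0 < h := hh.1
  set N := fNorm p (p - 2) t f
  have hl : Real.log 2 ≤ Real.log (2 / h) := by
    apply Real.log_le_log (by norm_num)
    rw [le_div_iff₀ hh0]
    linarith [hh.2]
  have hl0 : 0 < Real.log (2 / h) := lt_of_lt_of_le (Real.log_pos (by norm_num)) hl
  -- Only the value at radius $1-h$ produces a logarithm; the increment carries $h^{s-t}$ and will
  -- meet $h^t$.
  have hpt : ∀ z ∈ tent θ h, ‖f (z : ℂ)‖ₑ ^ p ≤ ENNReal.ofReal (2 ^ (p - 1)) *
      ((ENNReal.ofReal (C₁ * Real.log (2 / h)) * N) ^ p + ENNReal.ofReal (C₂ * h ^ (s - t)) *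
        ∫⁻ w in radialRegion ‖(z : ℂ)‖ h ((z : ℂ) / (‖(z : ℂ)‖ : ℂ)),
        ‖deriv f w‖ₑ ^ p * ENNReal.ofReal ((1 - ‖w‖) ^ (p - 2 - (s - t)))) := by
    intro z hz
    have hz0 := ne_zero_of_mem_tent hh.2 hz
    have hζ := norm_div_norm_of_ne_zero hz0
    set ζ : ℂ := (z : ℂ) / (‖(z : ℂ)‖ : ℂ) with hζd
    have hzζ : (z : ℂ) = (‖(z : ℂ)‖ : ℂ) * ζ := by
      rw [hζd, mul_div_cancel₀]
      exact_mod_cast (norm_ne_zero_iff.2 hz0)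
    have h1 := hinc f hf ζ hζ h hh ‖(z : ℂ)‖ hz.1 (norm_lt_one_of_mem_disc z.2)
    rw [← hzζ] at h1
    have hn : ‖((1 - h : ℝ) : ℂ) * ζ‖ = 1 - h := by
      rw [norm_mul, hζ, mul_one, Complex.norm_real, Real.norm_of_nonneg (by linarith [hh.2])]
    have h2 := hlog f hf _ (ofReal_mul_mem_disc hζ (by linarith [hh.2] : 0 ≤ 1 - h) (by linarith))
    rw [hn, sub_sub_cancel] at h2
    calc ‖f (z : ℂ)‖ₑ ^ p
        = ‖f ((1 - h : ℝ) * ζ) + (f z - f ((1 - h : ℝ) * ζ))‖ₑ ^ p := by rw [add_sub_cancel]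
      _ ≤ (‖f ((1 - h : ℝ) * ζ)‖ₑ + ‖f z - f ((1 - h : ℝ) * ζ)‖ₑ) ^ p := by
          gcongr
          exact enorm_add_le _ _
      _ ≤ 2 ^ (p - 1) * (‖f ((1 - h : ℝ) * ζ)‖ₑ ^ p + ‖f z - f ((1 - h : ℝ) * ζ)‖ₑ ^ p) :=
          ENNReal.rpow_add_le_mul_rpow_add_rpow _ _ hp.le
      _ ≤ _ := by
          rw [← ENNReal.ofReal_rpow_of_pos two_pos, ENNReal.ofReal_ofNat]
          gcongr
  calc ∫⁻ z in tent θ h, ‖f (z : ℂ)‖ₑ ^ p ∂μ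
      ≤ _ := setLIntegral_mono' (measurableSet_tent θ h) hpt
    _ = ENNReal.ofReal (2 ^ (p - 1)) * ((ENNReal.ofReal (C₁ * Real.log (2 / h)) * N) ^ p *
          μ (tent θ h) + ENNReal.ofReal (C₂ * h ^ (s - t)) *
        ∫⁻ z in tent θ h, (∫⁻ w in radialRegion ‖(z : ℂ)‖ h ((z : ℂ) / (‖(z : ℂ)‖ : ℂ)),
        ‖deriv f w‖ₑ ^ p * ENNReal.ofReal ((1 - ‖w‖) ^ (p - 2 - (s - t)))) ∂μ) := by
        rw [lintegral_const_mul' _ _ ENNReal.ofReal_ne_top, lintegral_add_left measurable_const,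
          lintegral_const, Measure.restrict_apply_univ,
          lintegral_const_mul' _ _ ENNReal.ofReal_ne_top]
    _ ≤ ENNReal.ofReal (2 ^ (p - 1)) * ((ENNReal.ofReal (C₁ * Real.log (2 / h)) * N) ^ p *
          (K * ENNReal.ofReal (h ^ s)) + ENNReal.ofReal (C₂ * h ^ (s - t)) *
          (K * ENNReal.ofReal (2 ^ s * (36 ^ t * h ^ t)) *
            (ENNReal.ofReal (2 ^ |p - 2|) * N ^ p))) := by
        gcongr
        · exact hK θ h hh
        · exact lintegral_radialRegion_tent_le hp ht hts hK f hh
    _ = ENNReal.ofReal (2 ^ (p - 1) * (C₁ ^ p * Real.log (2 / h) ^ p * h ^ s + B * h ^ s)) *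
          (K * N ^ p) := by
        have e : B * h ^ s =
            (C₂ * h ^ (s - t)) * (2 ^ s * (36 ^ t * h ^ t)) * 2 ^ |p - 2| := by
          have : h ^ s = h ^ (s - t) * h ^ t := by
            rw [← Real.rpow_add hh0]
            congr 1
            ring
          rw [hB, this]
          ring
        rw [e, ENNReal.ofReal_mul (p := 2 ^ (p - 1)) (by positivity), ENNReal.ofReal_add (by positivity)
          (by positivity), ENNReal.mul_rpow_of_nonneg _ _ hp0.le,
          ENNReal.ofReal_rpow_of_pos (by positivity), Real.mul_rpow hC₁.le hl0.le,
          ENNReal.ofReal_mul (q := h ^ s) (by positivity),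
          ENNReal.ofReal_mul (q := 2 ^ |p - 2|) (by positivity),
          ENNReal.ofReal_mul (p := C₂ * h ^ (s - t)) (by positivity)]
        ring
    _ ≤ _ := by
        gcongr ENNReal.ofReal ?_ * _
        -- The increment term has no logarithm; $2\log\frac2h\ge1$ inserts one, so both terms share
        -- a scale.
        have h2l : 1 ≤ 2 ^ p * Real.log (2 / h) ^ p := by
          rw [← Real.mul_rpow (by norm_num) hl0.le]
          exact Real.one_le_rpow (by linarith [one_le_two_mul_log_two]) hp0.le
        have h3 : B * h ^ s * 1 ≤ B * h ^ s * (2 ^ p * Real.log (2 / h) ^ p) := by gcongr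
        rw [mul_assoc (2 ^ (p - 1) : ℝ)]
        refine mul_le_mul_of_nonneg_left ?_ (by positivity)
        calc _ ≤ C₁ ^ p * Real.log (2 / h) ^ p * h ^ s +
              B * h ^ s * (2 ^ p * Real.log (2 / h) ^ p) := by linarith
          _ = _ := by ring

/-! ### Consequences of the vanishing Carleson condition. -/

lemma IsVanishingCarleson.exists_measure_tent_le {s : ℝ} {μ : Measure disc}
    (hμ : IsVanishingCarleson s μ) {ε : ℝ≥0∞} (hε : ε ≠ 0) :
    ∃ δ ∈ Ioc (0 : ℝ) 1, ∀ h ∈ Ioc (0 : ℝ) δ, ∀ θ, μ (tent θ h) ≤ ε * ENNReal.ofReal (h ^ s) := by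
  have h1 := (ENNReal.tendsto_nhds_zero.1 hμ) ε (pos_iff_ne_zero.2 hε)
  obtain ⟨δ, hδ, hsub⟩ := (mem_nhdsGT_iff_exists_Ioc_subset).1 h1
  refine ⟨min δ 1, ⟨lt_min hδ one_pos, min_le_right _ _⟩, fun h hh θ => ?_⟩
  have h2 : (⨆ θ : ℝ, μ (tent θ h) / ENNReal.ofReal (h ^ s)) ≤ ε :=
    hsub ⟨hh.1, hh.2.trans (min_le_left _ _)⟩
  have h3 : μ (tent θ h) / ENNReal.ofReal (h ^ s) ≤ ε :=
    (le_iSup (fun θ : ℝ => μ (tent θ h) / ENNReal.ofReal (h ^ s)) θ).trans h2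
  have h4 : 0 < h ^ s := Real.rpow_pos_of_pos hh.1 _
  rwa [ENNReal.div_le_iff (by simpa using h4) ENNReal.ofReal_ne_top] at h3

lemma isCompact_norm_le {r : ℝ} (hr : r < 1) : IsCompact {z : disc | ‖(z : ℂ)‖ ≤ r} := by
  rw [Subtype.isCompact_iff]
  have : ((↑) '' {z : disc | ‖(z : ℂ)‖ ≤ r} : Set ℂ) = closedBall 0 r := by
    ext z
    simp only [mem_image, Subtype.exists, mem_closedBall_zero_iff]
    constructor
    · rintro ⟨w, hw, hwr, rfl⟩
      exact hwr
    · intro hz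
      exact ⟨z, by rw [mem_ball_zero_iff]; linarith, hz, rfl⟩
  rw [this]
  exact isCompact_closedBall 0 r

lemma exists_tent_of_norm_gt {δ : ℝ} (hδ : δ ∈ Ioc (0 : ℝ) 1) {z : disc}
    (hz : 1 - δ < ‖(z : ℂ)‖) :
    ∃ k ∈ Finset.range (⌊1 / δ⌋₊ + 1),
      z ∈ tent (-Real.pi + 2 * Real.pi * δ * k + Real.pi * δ) δ := by
  have hpi := Real.pi_pos
  have hδ0 := hδ.1
  -- Position of the argument counted in arcs of angle $2\pi\delta$ from $-\pi$. The argument $\pi$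
  -- gives $x=1/\delta$, hence the extra index in the range.
  set x : ℝ := ((z : ℂ).arg + Real.pi) / (2 * Real.pi * δ) with hx
  have hx0 : 0 ≤ x := by
    have := Complex.neg_pi_lt_arg (z : ℂ)
    exact div_nonneg (by linarith) (by positivity)
  have hx1 : x ≤ 1 / δ := by
    have := Complex.arg_le_pi (z : ℂ)
    rw [hx, div_le_div_iff₀ (by positivity) hδ0]
    nlinarith
  have harg : (z : ℂ).arg = -Real.pi + 2 * Real.pi * δ * x := by
    rw [hx, mul_div_cancel₀ _ (by positivity)]
    ring
  refine ⟨⌊x⌋₊, Finset.mem_range.2 (Nat.lt_succ_of_le (Nat.floor_le_floor hx1)), hz, ?_⟩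
  have hz0 : (z : ℂ) ≠ 0 := by
    rw [← norm_pos_iff]
    linarith [hδ.2]
  have h1 := Nat.floor_le hx0
  have h2 := (Nat.lt_floor_add_one x).le
  have hc : 0 < 2 * Real.pi * δ := by positivity
  refine ⟨(z : ℂ).arg, ⟨?_, ?_⟩, ?_⟩
  · rw [harg]
    nlinarith
  · rw [harg]
    nlinarith
  · simp only
    rw [eq_div_iff (by exact_mod_cast norm_ne_zero_iff.2 hz0), mul_comm,
      Complex.norm_mul_exp_arg_mul_I]

/-- A compact disc and finitely many tents of one fixed small size cover everything, and each has
finite measure. -/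
lemma IsVanishingCarleson.isFiniteMeasure {s : ℝ} {μ : Measure disc} [IsLocallyFiniteMeasure μ]
    (hμ : IsVanishingCarleson s μ) : IsFiniteMeasure μ := by
  obtain ⟨δ, hδ, htent⟩ := hμ.exists_measure_tent_le one_ne_zero
  constructor
  have hsub : (univ : Set disc) ⊆ {z : disc | ‖(z : ℂ)‖ ≤ 1 - δ} ∪
      ⋃ k ∈ Finset.range (⌊1 / δ⌋₊ + 1),
        tent (-Real.pi + 2 * Real.pi * δ * k + Real.pi * δ) δ := by
    intro z _
    rcases le_or_gt ‖(z : ℂ)‖ (1 - δ) with h | h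
    · exact Or.inl h
    · obtain ⟨k, hk, hz⟩ := exists_tent_of_norm_gt hδ h
      exact Or.inr (mem_biUnion hk hz)
  refine (measure_mono hsub).trans_lt ((measure_union_le _ _).trans_lt ?_)
  refine ENNReal.add_lt_top.2 ⟨(isCompact_norm_le (by linarith [hδ.1])).measure_lt_top, ?_⟩
  refine (measure_biUnion_finset_le _ _).trans_lt (ENNReal.sum_lt_top.2 fun k _ => ?_)
  exact (htent δ ⟨hδ.1, le_rfl⟩ _).trans_lt (by simp)

lemma exists_measure_annulus_le (μ : Measure disc) [IsFiniteMeasure μ] {η : ℝ≥0∞} (hη : η ≠ 0) :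
    ∃ r ∈ Ioo (0 : ℝ) 1, μ {z : disc | r < ‖(z : ℂ)‖} ≤ η := by
  -- These annuli decrease to the empty set; the shift by $2$ keeps the inner radius positive even
  -- for `n = 0`.
  set S : ℕ → Set disc := fun n => {z | 1 - 1 / ((n : ℝ) + 2) < ‖(z : ℂ)‖} with hS
  have hSm : ∀ n, NullMeasurableSet (S n) μ := fun n =>
    (measurableSet_lt (by fun_prop) (by fun_prop)).nullMeasurableSet
  have hanti : Antitone S := by
    intro m n hmn z hz
    have h1 : 1 / ((n : ℝ) + 2) ≤ 1 / ((m : ℝ) + 2) := by gcongr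
    simp only [hS, mem_ofPred_eq] at hz ⊢
    linarith
  have hlim := tendsto_measure_iInter_atTop hSm hanti ⟨0, measure_ne_top _ _⟩
  have hemp : ⋂ n, S n = ∅ := by
    rw [eq_empty_iff_forall_notMem]
    intro z hz
    have hz1 := norm_lt_one_of_mem_disc z.2
    obtain ⟨n, hn⟩ := exists_nat_one_div_lt (sub_pos.2 hz1)
    have h1 : 1 / ((n : ℝ) + 2) ≤ 1 / ((n : ℝ) + 1) := by gcongr; norm_num
    have h2 := mem_iInter.1 hz n
    simp only [hS, mem_ofPred_eq] at h2
    linarith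
  rw [hemp, measure_empty] at hlim
  obtain ⟨n, hn⟩ := ((ENNReal.tendsto_nhds_zero.1 hlim) η (pos_iff_ne_zero.2 hη)).exists
  have h3 : 1 / ((n : ℝ) + 2) < 1 := by
    rw [div_lt_one (by positivity)]
    linarith [(Nat.cast_nonneg n : (0 : ℝ) ≤ n)]
  have h4 : 0 < 1 / ((n : ℝ) + 2) := by positivity
  exact ⟨1 - 1 / ((n : ℝ) + 2), ⟨by linarith, by linarith⟩, hn⟩

lemma IsVanishingCarleson.exists_hasCarlesonBound {s : ℝ} (hs : 0 < s) {μ : Measure disc}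
    [IsFiniteMeasure μ] (hμ : IsVanishingCarleson s μ) :
    ∃ K : ℝ≥0∞, K ≠ ∞ ∧ HasCarlesonBound s μ K := by
  obtain ⟨δ, hδ, htent⟩ := hμ.exists_measure_tent_le one_ne_zero
  have hd : 0 < δ ^ s := Real.rpow_pos_of_pos hδ.1 _
  have hd' : ENNReal.ofReal (δ ^ s) ≠ 0 := by simpa using hd
  refine ⟨1 + μ univ / ENNReal.ofReal (δ ^ s), ?_, fun θ h hh => ?_⟩
  · exact ENNReal.add_ne_top.2 ⟨ENNReal.one_ne_top, ENNReal.div_ne_top (measure_ne_top _ _) hd'⟩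
  · rcases le_or_gt h δ with h1 | h1
    · exact (htent h ⟨hh.1, h1⟩ θ).trans (by gcongr; exact le_self_add)
    · calc μ (tent θ h) ≤ μ univ := measure_mono (subset_univ _)
        _ = μ univ / ENNReal.ofReal (δ ^ s) * ENNReal.ofReal (δ ^ s) :=
            (ENNReal.div_mul_cancel hd' ENNReal.ofReal_ne_top).symm
        _ ≤ _ := by
            gcongr
            · exact le_add_self
            · exact hδ.1.le

/-- Short arcs use the vanishing condition at scale `δ`. For longer ones it suffices that the whole
annulus has mass at most $\varepsilon\delta^s$. -/
lemma IsVanishingCarleson.exists_hasCarlesonBound_restrict {s : ℝ} (hs : 0 < s) {μ : Measure disc}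
    [IsFiniteMeasure μ] (hμ : IsVanishingCarleson s μ) {ε : ℝ≥0∞} (hε : ε ≠ 0) :
    ∃ r ∈ Ioo (0 : ℝ) 1, HasCarlesonBound s (μ.restrict {z : disc | r < ‖(z : ℂ)‖}) ε := by
  obtain ⟨δ, hδ, htent⟩ := hμ.exists_measure_tent_le hε
  have hd : 0 < δ ^ s := Real.rpow_pos_of_pos hδ.1 _
  have hd' : ENNReal.ofReal (δ ^ s) ≠ 0 := by simpa using hd
  obtain ⟨r, hr, hle⟩ := exists_measure_annulus_le μ (mul_ne_zero hε hd')
  refine ⟨r, hr, fun θ h hh => ?_⟩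
  rcases le_or_gt h δ with h1 | h1
  · exact (Measure.restrict_apply_le _ _).trans (htent h ⟨hh.1, h1⟩ θ)
  · calc _ ≤ μ.restrict {z : disc | r < ‖(z : ℂ)‖} univ := measure_mono (subset_univ _)
      _ = μ {z : disc | r < ‖(z : ℂ)‖} := Measure.restrict_apply_univ _
      _ ≤ _ := hle
      _ ≤ _ := by
          gcongr
          exact hδ.1.le

/-! ### Tent norms, normal families and sufficiency. -/

lemma tent_scale_pos {p s h : ℝ} (hh : h ∈ Ioc (0 : ℝ) 1) : 0 < h ^ s * Real.log (2 / h) ^ p := by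
  have h1 : 1 < 2 / h := by
    rw [lt_div_iff₀ hh.1]
    linarith [hh.2]
  exact mul_pos (Real.rpow_pos_of_pos hh.1 _) (Real.rpow_pos_of_pos (Real.log_pos h1) _)

lemma tentNorm_le {p s : ℝ} (hp : 0 < p) {μ : Measure disc} {F : ℂ → ℂ} {A : ℝ≥0∞}
    (hA : ∀ θ : ℝ, ∀ h ∈ Ioc (0 : ℝ) 1, ∫⁻ z in tent θ h, ‖F (z : ℂ)‖ₑ ^ p ∂μ ≤
      A * ENNReal.ofReal (h ^ s * Real.log (2 / h) ^ p)) :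
    tentNorm p s μ F ≤ A ^ (1 / p) := by
  refine iSup_le fun θ => iSup₂_le fun h hh => ?_
  refine ENNReal.rpow_le_rpow (ENNReal.div_le_of_le_mul (hA θ h hh)) (by positivity)

lemma lintegral_tent_le_tentNorm {p s : ℝ} (hp : 0 < p) (μ : Measure disc) (F : ℂ → ℂ) (θ : ℝ)
    {h : ℝ} (hh : h ∈ Ioc (0 : ℝ) 1) : ∫⁻ z in tent θ h, ‖F (z : ℂ)‖ₑ ^ p ∂μ ≤
      tentNorm p s μ F ^ p * ENNReal.ofReal (h ^ s * Real.log (2 / h) ^ p) := by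
  have h1 : ((∫⁻ z in tent θ h, ‖F (z : ℂ)‖ₑ ^ p ∂μ) /
      ENNReal.ofReal (h ^ s * Real.log (2 / h) ^ p)) ^ (1 / p) ≤ tentNorm p s μ F :=
    (le_iSup₂ (f := fun h (_ : h ∈ Ioc (0 : ℝ) 1) => ((∫⁻ z in tent θ h, ‖F (z : ℂ)‖ₑ ^ p ∂μ) /
      ENNReal.ofReal (h ^ s * Real.log (2 / h) ^ p)) ^ (1 / p)) h hh).trans
      (le_iSup (fun θ => ⨆ h ∈ Ioc (0 : ℝ) 1, ((∫⁻ z in tent θ h, ‖F (z : ℂ)‖ₑ ^ p ∂μ) /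
      ENNReal.ofReal (h ^ s * Real.log (2 / h) ^ p)) ^ (1 / p)) θ)
  have h2 := ENNReal.rpow_le_rpow h1 hp.le
  rw [← ENNReal.rpow_mul, one_div, inv_mul_cancel₀ hp.ne', ENNReal.rpow_one,
    ENNReal.div_le_iff (by simpa using tent_scale_pos hh) ENNReal.ofReal_ne_top] at h2
  exact h2

/-- Montel's theorem on the unit disc. -/
lemma exists_subseq_tendstoLocallyUniformlyOn {f : ℕ → ℂ → ℂ}
    (hf : ∀ n, DifferentiableOn ℂ (f n) disc)
    (hb : ∀ r ∈ Ioo (0 : ℝ) 1, ∃ B : ℝ, ∀ n, ∀ z : ℂ, ‖z‖ ≤ r → ‖f n z‖ ≤ B) :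
    ∃ g : ℂ → ℂ, DifferentiableOn ℂ g disc ∧ ∃ k : ℕ → ℕ, StrictMono k ∧
      (∀ r ∈ Ioo (0 : ℝ) 1, TendstoUniformlyOn (fun n => f (k n)) g atTop (closedBall 0 r)) ∧
      TendstoLocallyUniformlyOn (fun n => f (k n)) g atTop disc := by
  choose! B hB using hb
  set c : ℕ → ℕ → ℂ := fun n j => ((j.factorial : ℂ))⁻¹ * iteratedDeriv j (f n) 0 with hc
  have hsum : ∀ n, ∀ z ∈ disc, HasSum (fun j => c n j * z ^ j) (f n z) := by
    intro n z hz
    have := Complex.hasSum_taylorSeries_on_ball (hf n) hz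
    convert! this using 2 with j
    simp only [hc, sub_zero, smul_eq_mul]
    ring
  have hcb : ∀ r ∈ Ioo (0 : ℝ) 1, ∀ n j, ‖c n j‖ ≤ B r / r ^ j := by
    intro r hr n j
    have hd : DiffContOnCl ℂ (f n) (ball 0 r) :=
      ((hf n).mono (closure_ball_subset_closedBall.trans
        (closedBall_subset_ball hr.2))).diffContOnCl
    have h1 := Complex.norm_iteratedDeriv_le_of_forall_mem_sphere_norm_le j hr.1 hd
      (fun z hz => hB r hr n z (by rw [mem_sphere_zero_iff_norm] at hz; exact hz.le))
    simp only [hc]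
    rw [norm_mul, norm_inv, Complex.norm_natCast, inv_mul_le_iff₀ (by positivity)]
    convert! h1 using 1
    ring
  have hhalf : (1 / 2 : ℝ) ∈ Ioo (0 : ℝ) 1 := by norm_num
  -- Cauchy estimates put the Taylor coefficients in a compact product. One radius suffices for
  -- extraction; the estimates at every other radius pass to the limit.
  have hcomp : IsCompact (Set.pi univ fun j : ℕ =>
      closedBall (0 : ℂ) (B (1 / 2) / (1 / 2) ^ j)) :=
    isCompact_univ_pi fun j => isCompact_closedBall _ _
  obtain ⟨b, -, k, hk, hlim⟩ := hcomp.tendsto_subseq (x := c) fun n j _ => by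
    rw [mem_closedBall_zero_iff]
    exact hcb _ hhalf n j
  rw [tendsto_pi_nhds] at hlim
  have hbb : ∀ r ∈ Ioo (0 : ℝ) 1, ∀ j, ‖b j‖ ≤ B r / r ^ j := fun r hr j =>
    le_of_tendsto (hlim j).norm (Eventually.of_forall fun n => hcb r hr _ j)
  set g : ℂ → ℂ := fun z => ∑' j, b j * z ^ j with hg
  have hunif : ∀ r ∈ Ioo (0 : ℝ) 1,
      TendstoUniformlyOn (fun n => f (k n)) g atTop (closedBall 0 r) := by
    intro r hr
    obtain ⟨R, hrR, hR1⟩ := exists_between hr.2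
    have hR : R ∈ Ioo (0 : ℝ) 1 := ⟨hr.1.trans hrR, hR1⟩
    have hR0 := hR.1
    -- Cauchy estimates at radius $R$ on $|z|\le r<R$ leave the ratio $r/R$, a domination
    -- independent of $n$.
    have hgeo : Summable fun j : ℕ => 2 * B R * (r / R) ^ j :=
      (summable_geometric_of_lt_one (div_nonneg hr.1.le hR0.le)
        ((div_lt_one hR0).2 hrR)).mul_left _
    have hdom : ∀ n j, ‖c (k n) j - b j‖ * r ^ j ≤ 2 * B R * (r / R) ^ j := by
      intro n j
      have h1 : ‖c (k n) j - b j‖ ≤ B R / R ^ j + B R / R ^ j :=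
        (norm_sub_le _ _).trans (add_le_add (hcb R hR _ j) (hbb R hR j))
      calc ‖c (k n) j - b j‖ * r ^ j ≤ (B R / R ^ j + B R / R ^ j) * r ^ j := by
            have := hr.1
            gcongr
        _ = _ := by
            rw [div_pow]
            ring
    have hlim0 : Tendsto (fun n => ∑' j, ‖c (k n) j - b j‖ * r ^ j) atTop (𝓝 0) := by
      have := tendsto_tsum_of_dominated_convergence (𝓕 := atTop)
        (f := fun n j => ‖c (k n) j - b j‖ * r ^ j) (g := fun _ => (0 : ℝ)) hgeo
        (fun j => ?_) (Eventually.of_forall fun n j => ?_)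
      · simpa using this
      · have h2 : Tendsto (fun n => ‖c (k n) j - b j‖) atTop (𝓝 0) := by
          have := ((hlim j).sub_const (b j)).norm
          simpa using this
        simpa using h2.mul_const (r ^ j)
      · rw [Real.norm_of_nonneg (mul_nonneg (norm_nonneg _) (pow_nonneg hr.1.le _))]
        exact hdom n j
    rw [Metric.tendstoUniformlyOn_iff]
    intro ε hε
    filter_upwards [hlim0.eventually (gt_mem_nhds hε)] with n hn z hz
    rw [mem_closedBall_zero_iff] at hz
    have hs : Summable fun j => ‖c (k n) j - b j‖ * r ^ j :=
      Summable.of_nonneg_of_le (fun j => mul_nonneg (norm_nonneg _) (pow_nonneg hr.1.le _))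
        (hdom n) hgeo
    have hle : ∀ j, ‖(c (k n) j - b j) * z ^ j‖ ≤ ‖c (k n) j - b j‖ * r ^ j := by
      intro j
      rw [norm_mul, norm_pow]
      gcongr
    have hs2 : Summable fun j => (c (k n) j - b j) * z ^ j := Summable.of_norm_bounded hs hle
    have h3 := hsum (k n) z (by rw [mem_ball_zero_iff]; linarith [hr.2])
    have h4 : HasSum (fun j => b j * z ^ j) (f (k n) z - ∑' j, (c (k n) j - b j) * z ^ j) := by
      convert! h3.sub hs2.hasSum using 2 with j
      ring
    have h5 : g z = f (k n) z - ∑' j, (c (k n) j - b j) * z ^ j := h4.tsum_eq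
    rw [h5, dist_eq_norm, sub_sub_cancel_left, norm_neg]
    exact (tsum_of_norm_bounded hs.hasSum hle).trans_lt hn
  have hloc : TendstoLocallyUniformlyOn (fun n => f (k n)) g atTop disc := by
    rw [tendstoLocallyUniformlyOn_iff_forall_isCompact isOpen_ball]
    intro K hKd hK
    obtain ⟨r, hr0, hr1, hKr⟩ : ∃ r : ℝ, 0 < r ∧ r < 1 ∧ K ⊆ closedBall 0 r := by
      rcases K.eq_empty_or_nonempty with rfl | hne
      · exact ⟨1 / 2, by norm_num, by norm_num, empty_subset _⟩
      obtain ⟨x, hx, hmax⟩ := hK.exists_isMaxOn hne continuous_norm.continuousOn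
      have hx1 := norm_lt_one_of_mem_disc (hKd hx)
      refine ⟨max ‖x‖ (1 / 2), lt_max_of_lt_right (by norm_num), max_lt hx1 (by norm_num),
        fun y hy => ?_⟩
      rw [mem_closedBall_zero_iff]
      exact le_max_of_le_left (hmax hy)
    exact (hunif r ⟨hr0, hr1⟩).mono hKr
  exact ⟨g, hloc.differentiableOn (Eventually.of_forall fun n => hf _) isOpen_ball, k, hk, hunif,
    hloc⟩

/-- Derivatives converge pointwise, so Fatou applies for each $a$. The factor $2$ arises from
bounding $|g(0)|$ and the supremum separately by $M$. -/
lemma fNorm_le_of_tendstoLocallyUniformlyOn {p q t : ℝ} (hp : 0 < p) {f : ℕ → ℂ → ℂ} {g : ℂ → ℂ}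
    (hf : ∀ n, DifferentiableOn ℂ (f n) disc) (hlim : TendstoLocallyUniformlyOn f g atTop disc)
    {M : ℝ≥0∞} (hM : ∀ n, fNorm p q t (f n) ≤ M) : fNorm p q t g ≤ 2 * M := by
  have h0 : ‖g 0‖ₑ ≤ M := by
    have h1 : Tendsto (fun n => f n 0) atTop (𝓝 (g 0)) :=
      hlim.tendsto_at (by simp)
    exact le_of_tendsto h1.enorm
      (Eventually.of_forall fun n => (enorm_zero_le_fNorm _ _ _ _).trans (hM n))
  have hd : ∀ z ∈ disc, Tendsto (fun n => deriv (f n) z) atTop (𝓝 (deriv g z)) := fun z hz =>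
    (hlim.deriv (Eventually.of_forall hf) isOpen_ball).tendsto_at hz
  rw [two_mul]
  refine add_le_add h0 (iSup₂_le fun a ha => ?_)
  set W : ℂ → ℝ≥0∞ := fun z => ENNReal.ofReal ((1 - ‖z‖ ^ 2) ^ q * (1 - ‖mobius a z‖ ^ 2) ^ t)
  have hWm : Measurable W := by
    unfold W mobius
    fun_prop
  have hFatou : ∫⁻ z in disc, ‖deriv g z‖ₑ ^ p * W z ≤ M ^ p := by
    calc ∫⁻ z in disc, ‖deriv g z‖ₑ ^ p * W z
        = ∫⁻ z in disc, liminf (fun n => ‖deriv (f n) z‖ₑ ^ p * W z) atTop := by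
          refine setLIntegral_congr_fun measurableSet_ball fun z hz => ?_
          refine (Tendsto.liminf_eq ?_).symm
          refine ENNReal.Tendsto.mul_const ?_ (Or.inr ENNReal.ofReal_ne_top)
          exact ((hd z hz).enorm).ennrpow_const p
      _ ≤ liminf (fun n => ∫⁻ z in disc, ‖deriv (f n) z‖ₑ ^ p * W z) atTop :=
          lintegral_liminf_le fun n => ((measurable_deriv (f n)).enorm.pow_const p).mul hWm
      _ ≤ M ^ p := by
          refine liminf_le_of_le (by isBoundedDefault) fun b hb => ?_
          obtain ⟨n, hn⟩ := hb.exists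
          exact hn.trans ((lintegral_le_fNorm_rpow hp (f n) ha).trans
            (ENNReal.rpow_le_rpow (hM n) hp.le))
  have h2 := ENNReal.rpow_le_rpow hFatou (by positivity : 0 ≤ 1 / p)
  rwa [← ENNReal.rpow_mul, mul_one_div_cancel hp.ne', ENNReal.rpow_one] at h2

lemma tentNorm_lt_top {p t s : ℝ} (hp : 1 < p) (ht : 0 < t) (hts : t < s) (hs : s ≤ 1)
    {μ : Measure disc} [SFinite μ] {K : ℝ≥0∞} (hK : HasCarlesonBound s μ K) (hKt : K ≠ ∞)
    {f : ℂ → ℂ} (hf : DifferentiableOn ℂ f disc) (hfN : fNorm p (p - 2) t f < ∞) :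
    tentNorm p s μ f < ∞ := by
  obtain ⟨C, hC, h⟩ := exists_lintegral_tent_le hp ht hts hs
  have hp0 : 0 < p := by linarith
  refine (tentNorm_le hp0 (A := ENNReal.ofReal C * (K * fNorm p (p - 2) t f ^ p))
    fun θ r hr => ?_).trans_lt ?_
  · refine (h μ K hK f hf θ r hr).trans (le_of_eq ?_)
    rw [ENNReal.ofReal_mul hC.le]
    ring
  · exact ENNReal.rpow_lt_top_of_nonneg (by positivity)
      (ENNReal.mul_ne_top ENNReal.ofReal_ne_top
        (ENNReal.mul_ne_top hKt (ENNReal.rpow_ne_top_of_nonneg hp0.le hfN.ne)))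

/-- Outside radius $r$ the two functions are estimated separately by $A$; inside, their difference
is at most `τ`. -/
lemma tentNorm_sub_le {p s r τ : ℝ} (hp : 1 < p) (hs : 0 < s) (hr : r ∈ Ioo (0 : ℝ) 1)
    {μ : Measure disc} {f g : ℂ → ℂ} (hf : DifferentiableOn ℂ f disc)
    (hτ : ∀ z : ℂ, ‖z‖ ≤ r → ‖f z - g z‖ ≤ τ) {A : ℝ≥0∞}
    (hA : ∀ F ∈ ({f, g} : Set (ℂ → ℂ)), ∀ θ : ℝ, ∀ h ∈ Ioc (0 : ℝ) 1,
      ∫⁻ z in tent θ h, ‖F (z : ℂ)‖ₑ ^ p ∂(μ.restrict {z : disc | r < ‖(z : ℂ)‖}) ≤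
        A * ENNReal.ofReal (h ^ s * Real.log (2 / h) ^ p)) :
    tentNorm p s μ (f - g) ≤ (2 ^ p * A + ENNReal.ofReal τ ^ p *
      (μ {z : disc | ‖(z : ℂ)‖ ≤ r} /
        ENNReal.ofReal ((1 - r) ^ s * Real.log 2 ^ p))) ^ (1 / p) := by
  have hp0 : 0 < p := by linarith
  have hfm : Measurable fun z : disc => f z := by
    have : Continuous fun z : disc => f z := continuousOn_iff_continuous_domRestrict.1 hf.continuousOn
    exact this.measurable
  refine tentNorm_le hp0 fun θ h hh => ?_
  set S : Set disc := {z : disc | r < ‖(z : ℂ)‖} with hS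
  have hSm : MeasurableSet S := measurableSet_lt (by fun_prop) (by fun_prop)
  have hTm := measurableSet_tent θ h
  set D : ℝ := h ^ s * Real.log (2 / h) ^ p with hD
  have hD0 : 0 < D := tent_scale_pos hh
  have hlog2 : 0 < Real.log 2 := Real.log_pos (by norm_num)
  set d : ℝ := (1 - r) ^ s * Real.log 2 ^ p with hd
  have hr1 : 0 < 1 - r := by linarith [hr.2]
  have hd0 : 0 < d := by positivity
  rw [← lintegral_inter_add_sdiff (fun z : disc => ‖(f - g) (z : ℂ)‖ₑ ^ p) (tent θ h) hSm, add_mul]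
  refine add_le_add ?_ ?_
  · rw [← Measure.restrict_restrict hTm]
    calc ∫⁻ z in tent θ h, ‖(f - g) (z : ℂ)‖ₑ ^ p ∂(μ.restrict S)
        ≤ ∫⁻ z in tent θ h, 2 ^ (p - 1) * (‖f (z : ℂ)‖ₑ ^ p + ‖g (z : ℂ)‖ₑ ^ p)
            ∂(μ.restrict S) := by
          refine lintegral_mono fun z => ?_
          refine le_trans ?_ (ENNReal.rpow_add_le_mul_rpow_add_rpow _ _ hp.le)
          gcongr
          exact enorm_sub_le
      _ = 2 ^ (p - 1) * (∫⁻ z in tent θ h, ‖f (z : ℂ)‖ₑ ^ p ∂(μ.restrict S) +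
            ∫⁻ z in tent θ h, ‖g (z : ℂ)‖ₑ ^ p ∂(μ.restrict S)) := by
          rw [lintegral_const_mul' _ _ (ENNReal.rpow_ne_top_of_nonneg (by linarith) (by simp)),
            lintegral_add_left (hfm.enorm.pow_const p)]
      _ ≤ 2 ^ (p - 1) * (A * ENNReal.ofReal D + A * ENNReal.ofReal D) := by
          gcongr
          · exact hA f (by simp) θ h hh
          · exact hA g (by simp) θ h hh
      _ = 2 ^ p * A * ENNReal.ofReal D := by
          have : (2 : ℝ≥0∞) ^ p = 2 ^ (p - 1) * 2 := by
            conv_rhs => rw [← ENNReal.rpow_one 2, ← ENNReal.rpow_mul, one_mul]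
            rw [← ENNReal.rpow_add _ _ (by norm_num) (by norm_num), sub_add_cancel]
          rw [this]
          ring
  · rcases (tent θ h \ S).eq_empty_or_nonempty with hemp | ⟨z, hz1, hz2⟩
    · simp [hemp]
    -- A tent reaching into $|z|\le r$ cannot be short, so its normalizing factor is bounded below
    -- factor by factor.
    have hrh : 1 - r ≤ h := by
      have h1 := hz1.1
      have h2 : ‖(z : ℂ)‖ ≤ r := not_lt.1 hz2
      linarith
    have hdD : d ≤ D := by
      rw [hd, hD]
      gcongr
      · exact Real.rpow_nonneg hh.1.le _
      · rw [le_div_iff₀ hh.1]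
        linarith [hh.2]
    have hdne : ENNReal.ofReal d ≠ 0 := by simpa using hd0
    calc ∫⁻ z in tent θ h \ S, ‖(f - g) (z : ℂ)‖ₑ ^ p ∂μ
        ≤ ∫⁻ z in tent θ h \ S, ENNReal.ofReal τ ^ p ∂μ := by
          refine setLIntegral_mono' (hTm.diff hSm) fun z hz => ?_
          gcongr
          rw [← ofReal_norm]
          exact ENNReal.ofReal_le_ofReal (hτ z (not_lt.1 hz.2))
      _ = ENNReal.ofReal τ ^ p * μ (tent θ h \ S) := by
          rw [lintegral_const, Measure.restrict_apply_univ]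
      _ ≤ ENNReal.ofReal τ ^ p * μ {z : disc | ‖(z : ℂ)‖ ≤ r} := by
          gcongr
          intro z hz
          have : ‖(z : ℂ)‖ ≤ r := not_lt.1 hz.2
          exact this
      _ = ENNReal.ofReal τ ^ p * (μ {z : disc | ‖(z : ℂ)‖ ≤ r} / ENNReal.ofReal d) *
            ENNReal.ofReal d := by
          rw [mul_assoc, ENNReal.div_mul_cancel hdne ENNReal.ofReal_ne_top]
      _ ≤ _ := by gcongr

/-- A vanishing `s`-Carleson measure gives a compact embedding of `F(p, p - 2, t)`, `t < s`. -/
theorem isCompactId_of_isVanishingCarleson {p t s : ℝ} (hp : 1 < p) (ht : 0 < t) (hts : t < s)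
    (hs : s ≤ 1) {μ : Measure disc} [IsLocallyFiniteMeasure μ] (hμ : IsVanishingCarleson s μ) :
    IsCompactId (fNorm p (p - 2) t) (tentNorm p s μ) := by
  have hp0 : 0 < p := by linarith
  have hs0 : 0 < s := ht.trans hts
  have := hμ.isFiniteMeasure
  obtain ⟨K, hKt, hK⟩ := hμ.exists_hasCarlesonBound hs0
  refine ⟨fun f hf => ⟨hf.1, tentNorm_lt_top hp ht hts hs hK hKt hf.1 hf.2⟩, ?_⟩
  rintro f hf ⟨M, hMt, hM⟩
  obtain ⟨C₁, hC₁, hlog⟩ := exists_enorm_le_log hp ht (by linarith : t ≤ 1)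
  have hb : ∀ r ∈ Ioo (0 : ℝ) 1, ∃ B : ℝ, ∀ n, ∀ z : ℂ, ‖z‖ ≤ r → ‖f n z‖ ≤ B := by
    intro r hr
    refine ⟨(ENNReal.ofReal (C₁ * Real.log (2 / (1 - r))) * M).toReal, fun n z hz => ?_⟩
    have hz1 : ‖z‖ < 1 := hz.trans_lt hr.2
    have h1 : ‖f n z‖ₑ ≤ ENNReal.ofReal (C₁ * Real.log (2 / (1 - r))) * M := by
      refine (hlog (f n) (hf n).1 z (by rwa [mem_ball_zero_iff])).trans ?_
      have : 0 < 1 - r := by linarith [hr.2]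
      have : 0 < 1 - ‖z‖ := by linarith
      gcongr
      exact hM n
    rw [← toReal_enorm]
    exact ENNReal.toReal_mono (ENNReal.mul_ne_top ENNReal.ofReal_ne_top hMt.ne) h1
  obtain ⟨g, hg, k, hk, hunif, hloc⟩ :=
    exists_subseq_tendstoLocallyUniformlyOn (fun n => (hf n).1) hb
  have hgN : fNorm p (p - 2) t g ≤ 2 * M :=
    fNorm_le_of_tendstoLocallyUniformlyOn hp0 (fun n => (hf (k n)).1) hloc fun n => hM _
  have h2M : 2 * M ≠ ∞ := ENNReal.mul_ne_top (by simp) hMt.ne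
  refine ⟨g, ⟨hg, tentNorm_lt_top hp ht hts hs hK hKt hg (hgN.trans_lt h2M.lt_top)⟩, k, hk, ?_⟩
  obtain ⟨C, hC, hC'⟩ := exists_lintegral_tent_le hp ht hts hs
  rw [ENNReal.tendsto_nhds_zero]
  intro ε hε
  -- One half pays for the annulus, through the Carleson constant `δ`; the other pays for the
  -- compact core, through `τ`, where $\tau^p=x$.
  set η : ℝ≥0∞ := ε ^ p / 2 with hη
  have hη0 : η ≠ 0 := by
    rw [hη]
    simp only [ne_eq, ENNReal.div_eq_zero_iff, not_or]
    exact ⟨(ENNReal.rpow_pos_of_nonneg hε hp0.le).ne', by simp⟩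
  set Q : ℝ≥0∞ := 2 ^ p * (ENNReal.ofReal C * (2 * M) ^ p) with hQ
  have hQt : Q ≠ ∞ := by
    refine ENNReal.mul_ne_top (ENNReal.rpow_ne_top_of_nonneg hp0.le (by simp))
      (ENNReal.mul_ne_top ENNReal.ofReal_ne_top (ENNReal.rpow_ne_top_of_nonneg hp0.le h2M))
  obtain ⟨δ, hδ0, hδ⟩ := ENNReal.exists_nnreal_pos_mul_lt hQt hη0
  obtain ⟨r, hr, hbd⟩ := hμ.exists_hasCarlesonBound_restrict hs0
    (ε := (δ : ℝ≥0∞)) (by simpa using hδ0.ne')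
  set P : ℝ≥0∞ := μ {z : disc | ‖(z : ℂ)‖ ≤ r} /
    ENNReal.ofReal ((1 - r) ^ s * Real.log 2 ^ p) with hP
  have hlog2 : 0 < Real.log 2 := Real.log_pos (by norm_num)
  have hr1 : 0 < 1 - r := by linarith [hr.2]
  have hPt : P ≠ ∞ := ENNReal.div_ne_top (measure_ne_top _ _) (by
    have : 0 < (1 - r) ^ s * Real.log 2 ^ p := by positivity
    simpa using this)
  obtain ⟨x, hx0, hx⟩ := ENNReal.exists_nnreal_pos_mul_lt hPt hη0
  have hx0' : (0 : ℝ) < x := hx0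
  set τ : ℝ := (x : ℝ) ^ (1 / p) with hτ
  have hτ0 : 0 < τ := by positivity
  have hτp : ENNReal.ofReal τ ^ p = x := by
    rw [ENNReal.ofReal_rpow_of_pos hτ0, hτ, ← Real.rpow_mul hx0'.le, one_div_mul_cancel hp0.ne',
      Real.rpow_one, ENNReal.ofReal_coe_nnreal]
  filter_upwards [Metric.tendstoUniformlyOn_iff.1 (hunif r hr) τ hτ0] with n hn
  have hA : ∀ F ∈ ({f (k n), g} : Set (ℂ → ℂ)), ∀ θ : ℝ, ∀ h ∈ Ioc (0 : ℝ) 1,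
      ∫⁻ z in tent θ h, ‖F (z : ℂ)‖ₑ ^ p ∂(μ.restrict {z : disc | r < ‖(z : ℂ)‖}) ≤
        (ENNReal.ofReal C * (δ * (2 * M) ^ p)) *
          ENNReal.ofReal (h ^ s * Real.log (2 / h) ^ p) := by
    intro F hF θ h hh
    have hF' : DifferentiableOn ℂ F disc ∧ fNorm p (p - 2) t F ≤ 2 * M := by
      rcases hF with rfl | rfl
      · refine ⟨(hf _).1, (hM _).trans ?_⟩
        rw [two_mul]
        exact le_self_add
      · exact ⟨hg, hgN⟩
    refine (hC' _ _ hbd F hF'.1 θ h hh).trans ?_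
    rw [ENNReal.ofReal_mul hC.le, mul_right_comm]
    gcongr
    exact hF'.2
  have hτ' : ∀ z : ℂ, ‖z‖ ≤ r → ‖f (k n) z - g z‖ ≤ τ := by
    intro z hz
    have := hn z (by simpa using hz)
    rw [dist_comm, dist_eq_norm] at this
    exact this.le
  refine (tentNorm_sub_le hp hs0 hr (hf (k n)).1 hτ' hA).trans ?_
  rw [hτp]
  have hsum : 2 ^ p * (ENNReal.ofReal C * (δ * (2 * M) ^ p)) + x * P ≤ ε ^ p := by
    calc _ = δ * Q + x * P := by rw [hQ]; ring
      _ ≤ η + η := add_le_add hδ.le hx.le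
      _ = ε ^ p := ENNReal.add_halves _
  refine (ENNReal.rpow_le_rpow hsum (by positivity)).trans (le_of_eq ?_)
  rw [← ENNReal.rpow_mul, mul_one_div_cancel hp0.ne', ENNReal.rpow_one]

/-! ### A Forelli-Rudin integral. -/

/-- The chord bound gives
$2|\theta|/\pi\le|1-e^{i\theta}|\le|1-re^{i\theta}|+(1-r)\le2|1-re^{i\theta}|$. -/
lemma abs_div_pi_le_norm_one_sub_circleMap {r θ : ℝ} (h0 : 0 ≤ r) (h1 : r ≤ 1)
    (hθ : θ ∈ Ioo (-Real.pi) Real.pi) : |θ| / Real.pi ≤ ‖1 - circleMap 0 r θ‖ := by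
  have hpi := Real.pi_pos
  have harg : (Complex.exp (θ * Complex.I)).arg = θ := by
    rw [Complex.exp_mul_I]
    exact Complex.arg_cos_add_sin_mul_I ⟨hθ.1, hθ.2.le⟩
  have hang := Complex.mul_angle_le_norm_sub (x := 1) (y := Complex.exp (θ * Complex.I)) norm_one
    (Complex.norm_exp_ofReal_mul_I θ)
  rw [Complex.angle_one_left (Complex.exp_ne_zero _), harg] at hang
  have e : circleMap 0 r θ = r * Complex.exp (θ * Complex.I) := by simp [circleMap]
  have hn : ‖circleMap 0 r θ‖ = r := by rw [e, norm_ofReal_mul_exp r θ h0]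
  have h2 : 1 - r ≤ ‖1 - circleMap 0 r θ‖ := by
    have := norm_sub_norm_le 1 (circleMap 0 r θ)
    rwa [norm_one, hn] at this
  have h3 : ‖circleMap 0 r θ - Complex.exp (θ * Complex.I)‖ = 1 - r := by
    have : circleMap 0 r θ - Complex.exp (θ * Complex.I) =
        ((r - 1 : ℝ) : ℂ) * Complex.exp (θ * Complex.I) := by
      rw [e]
      push_cast
      ring
    rw [this, norm_mul, Complex.norm_exp_ofReal_mul_I, mul_one, Complex.norm_real,
      Real.norm_eq_abs, abs_sub_comm, abs_of_nonneg (by linarith)]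
  have h4 := norm_sub_le_norm_sub_add_norm_sub 1 (circleMap 0 r θ) (Complex.exp (θ * Complex.I))
  rw [h3] at h4
  have h5 : 2 / Real.pi * |θ| = 2 * (|θ| / Real.pi) := by ring
  linarith

lemma lintegral_abs_rpow_lt_top {τ : ℝ} (hτ : 0 < τ) :
    ∫⁻ θ in Ioo (-Real.pi) Real.pi, ENNReal.ofReal ((|θ| / Real.pi) ^ (τ - 1)) < ∞ := by
  have hpi := Real.pi_pos
  have h1 : IntervalIntegrable (fun θ : ℝ => |θ| ^ (τ - 1)) volume (-Real.pi) Real.pi := by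
    refine intervalIntegrable_of_even (fun x => by simp) fun x hx => ?_
    refine (intervalIntegral.intervalIntegrable_rpow' (r := τ - 1) (by linarith)).congr ?_
    intro y hy
    rw [uIoc_of_le hx.le] at hy
    simp only [abs_of_pos hy.1]
  have h2 : IntegrableOn (fun θ : ℝ => |θ| ^ (τ - 1) / Real.pi ^ (τ - 1))
      (Ioc (-Real.pi) Real.pi) := h1.1.div_const _
  have h3 := (h2.mono_set Ioo_subset_Ioc_self).lintegral_lt_top
  refine lt_of_le_of_lt (le_of_eq (lintegral_congr fun θ => ?_)) h3
  rw [Real.div_rpow (abs_nonneg _) hpi.le]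

/-- In polar coordinates the integrand is dominated by a product of a radial and an angular
singularity, both integrable because $\tau>0$. -/
lemma lintegral_disc_model_lt_top {τ : ℝ} (hτ : 0 < τ) (hτ1 : τ < 1) :
    ∫⁻ w in disc, ENNReal.ofReal ((1 - ‖w‖) ^ (τ - 1) * ‖1 - w‖ ^ (τ - 1)) < ∞ := by
  set Φ : ℂ → ℝ≥0∞ := fun w => ENNReal.ofReal ((1 - ‖w‖) ^ (τ - 1) * ‖1 - w‖ ^ (τ - 1)) with hΦ
  have hΦm : Measurable Φ := by fun_prop
  set A := ∫⁻ θ in Ioo (-Real.pi) Real.pi, ENNReal.ofReal ((|θ| / Real.pi) ^ (τ - 1)) with hA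
  have hAt : A < ∞ := lintegral_abs_rpow_lt_top hτ
  rw [← lintegral_indicator measurableSet_ball,
    lintegral_eq_lintegral_circleMap (hΦm.indicator measurableSet_ball)]
  -- The interval is written `Ioc (1 - 1) 1` to match `lintegral_one_sub_rpow` at `h = 1`.
  have hpt : ∀ r ∈ Ioi (0 : ℝ), ENNReal.ofReal r *
      ∫⁻ θ in Ioo (-Real.pi) Real.pi, disc.indicator Φ (circleMap 0 r θ) ≤
      (Ioc (1 - 1) 1 : Set ℝ).indicator
        (fun r => ENNReal.ofReal ((1 - r) ^ (τ - 1)) * A) r := by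
    intro r hr
    have hr0 : 0 < r := hr
    rcases lt_or_ge r 1 with h1 | h1
    · rw [indicator_of_mem (by constructor <;> linarith)]
      have h2 : ∫⁻ θ in Ioo (-Real.pi) Real.pi, disc.indicator Φ (circleMap 0 r θ) ≤
          ENNReal.ofReal ((1 - r) ^ (τ - 1)) * A := by
        rw [hA, ← lintegral_const_mul' _ _ ENNReal.ofReal_ne_top]
        refine lintegral_mono_ae ?_
        rw [ae_restrict_iff' measurableSet_Ioo]
        filter_upwards [Measure.ae_ne volume (0 : ℝ)] with θ hθ0 hθ
        have h3 := abs_div_pi_le_norm_one_sub_circleMap hr0.le h1.le hθ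
        have hn : ‖circleMap 0 r θ‖ = r := by simp [abs_of_pos hr0]
        refine (indicator_le_self _ _ _).trans ?_
        rw [hΦ]
        simp only
        have hr1 : 0 < 1 - r := by linarith
        rw [hn, ← ENNReal.ofReal_mul (by positivity)]
        refine ENNReal.ofReal_le_ofReal (mul_le_mul_of_nonneg_left ?_ (by positivity))
        exact Real.rpow_le_rpow_of_nonpos (div_pos (abs_pos.2 hθ0) Real.pi_pos) h3 (by linarith)
      calc _ ≤ ENNReal.ofReal 1 * (ENNReal.ofReal ((1 - r) ^ (τ - 1)) * A) := by gcongr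
        _ = _ := by rw [ENNReal.ofReal_one, one_mul]
    · have h2 : ∀ θ, disc.indicator Φ (circleMap 0 r θ) = 0 := fun θ => by
        refine indicator_of_notMem ?_ _
        rw [mem_ball_zero_iff]
        simpa [abs_of_pos hr0] using h1
      simp [h2]
  refine (setLIntegral_mono' measurableSet_Ioi hpt).trans_lt ?_
  refine (setLIntegral_le_lintegral _ _).trans_lt ?_
  rw [lintegral_indicator measurableSet_Ioc, lintegral_mul_const _ (by fun_prop),
    lintegral_one_sub_rpow zero_le_one hτ]
  exact ENNReal.mul_lt_top ENNReal.ofReal_lt_top hAt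

lemma lintegral_disc_rotate (η : Circle) {F : ℂ → ℝ≥0∞} :
    ∫⁻ w in disc, F (η * w) = ∫⁻ w in disc, F w := by
  have h := (rotation η).measurePreserving.lintegral_comp_emb
    (rotation η).toHomeomorph.measurableEmbedding (disc.indicator F)
  rw [← lintegral_indicator measurableSet_ball, ← lintegral_indicator measurableSet_ball, ← h]
  refine lintegral_congr fun w => ?_
  rw [rotation_apply]
  simp only [indicator, mem_ball_zero_iff, norm_mul, Circle.norm_coe, one_mul]

/-- A Forelli-Rudin estimate. -/
lemma exists_lintegral_kernel_le {p t : ℝ} (hp : 1 < p) (ht : 0 < t) (ht1 : t ≤ 1) :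
    ∃ C : ℝ≥0∞, C ≠ ∞ ∧ ∀ c ∈ disc, ∫⁻ w in disc, ENNReal.ofReal ((1 - ‖w‖ ^ 2) ^ (p - 2 + t) *
      (1 / ‖1 - (starRingEnd ℂ) c * w‖) ^ p) ≤ C := by
  -- The kernel $D^{-p}$ is split as $D^{-(p-1+\tau)}D^{\tau-1}$, bounded using $D\ge1-|v|$ and
  -- $D\ge\frac12|1-v|$. With $\tau=t/2$ both resulting exponents equal $\tau-1$.
  set τ : ℝ := t / 2 with hτ
  have hτ0 : 0 < τ := by positivity
  have hτ1 : τ < 1 := by linarith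
  set B : ℝ := 2 ^ |p - 2 + t| * (1 / 2) ^ (τ - 1) with hB
  refine ⟨ENNReal.ofReal B * ∫⁻ w in disc,
    ENNReal.ofReal ((1 - ‖w‖) ^ (τ - 1) * ‖1 - w‖ ^ (τ - 1)),
    ENNReal.mul_ne_top ENNReal.ofReal_ne_top (lintegral_disc_model_lt_top hτ0 hτ1).ne,
    fun c hc => ?_⟩
  have hc1 := norm_lt_one_of_mem_disc hc
  -- A rotation replaces $\bar c$ by $|c|$, leaving a singularity at the fixed point $1$.
  set η : Circle := Circle.exp (-c.arg) with hη
  have hcη : (starRingEnd ℂ) c = ‖c‖ * η := by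
    conv_lhs => rw [← Complex.norm_mul_exp_arg_mul_I c]
    rw [map_mul, Complex.conj_ofReal, ← Complex.exp_conj, hη, Circle.coe_exp]
    simp
  rw [← lintegral_disc_rotate η (F := fun w =>
    ENNReal.ofReal ((1 - ‖w‖) ^ (τ - 1) * ‖1 - w‖ ^ (τ - 1))),
    ← lintegral_const_mul' _ _ ENNReal.ofReal_ne_top]
  refine setLIntegral_mono' measurableSet_ball fun w hw => ?_
  have hw1 := norm_lt_one_of_mem_disc hw
  rw [← ENNReal.ofReal_mul (by positivity)]
  refine ENNReal.ofReal_le_ofReal ?_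
  set v : ℂ := η * w with hv
  have hnv : ‖v‖ = ‖w‖ := by rw [hv, norm_mul, Circle.norm_coe, one_mul]
  have hcv : (starRingEnd ℂ) c * w = ‖c‖ * v := by rw [hcη, hv, mul_assoc]
  rw [hcv, ← hnv]
  rw [← hnv] at hw1
  have hx : 0 < 1 - ‖v‖ := by linarith
  have hcvn : ‖(‖c‖ : ℂ) * v‖ = ‖c‖ * ‖v‖ := by rw [norm_mul, Complex.norm_real, norm_norm]
  set D := ‖1 - (‖c‖ : ℂ) * v‖ with hD
  have hD1 : 1 - ‖c‖ * ‖v‖ ≤ D := by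
    have := norm_sub_norm_le 1 ((‖c‖ : ℂ) * v)
    rwa [norm_one, hcvn] at this
  have hDx : 1 - ‖v‖ ≤ D := by nlinarith [norm_nonneg v, norm_nonneg c]
  have hDc : 1 - ‖c‖ ≤ D := by nlinarith [norm_nonneg v, norm_nonneg c]
  have hD0 : 0 < D := by linarith
  have hv1 : 0 < ‖1 - v‖ := by
    have := norm_sub_norm_le 1 v
    rw [norm_one] at this
    linarith
  have hDv : 1 / 2 * ‖1 - v‖ ≤ D := by
    have e : 1 - v = (1 - (‖c‖ : ℂ) * v) - ((1 - ‖c‖ : ℝ) : ℂ) * v := by push_cast; ring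
    have h1 := norm_sub_le (1 - (‖c‖ : ℂ) * v) (((1 - ‖c‖ : ℝ) : ℂ) * v)
    rw [← e, norm_mul, Complex.norm_real, Real.norm_of_nonneg (by linarith)] at h1
    nlinarith [norm_nonneg v]
  have h1 : (1 - ‖v‖ ^ 2) ^ (p - 2 + t) ≤ 2 ^ |p - 2 + t| * (1 - ‖v‖) ^ (p - 2 + t) :=
    rpow_le_rpow_abs_mul_rpow (by nlinarith [norm_nonneg v]) hx (by norm_num)
      (by nlinarith [norm_nonneg v]) (by nlinarith [norm_nonneg v])
  have h2 : (1 / D) ^ p ≤ (1 - ‖v‖) ^ (-(p - 1 + τ)) * ((1 / 2) ^ (τ - 1) * ‖1 - v‖ ^ (τ - 1)) := by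
    rw [← Real.mul_rpow (by norm_num) hv1.le, one_div, Real.inv_rpow hD0.le, ← Real.rpow_neg hD0.le,
      show -p = -(p - 1 + τ) + (τ - 1) by ring, Real.rpow_add hD0]
    gcongr ?_ * ?_
    · exact Real.rpow_le_rpow_of_nonpos hx hDx (by linarith)
    · exact Real.rpow_le_rpow_of_nonpos (by positivity) hDv (by linarith)
  calc (1 - ‖v‖ ^ 2) ^ (p - 2 + t) * (1 / D) ^ p
      ≤ (2 ^ |p - 2 + t| * (1 - ‖v‖) ^ (p - 2 + t)) *
        ((1 - ‖v‖) ^ (-(p - 1 + τ)) * ((1 / 2) ^ (τ - 1) * ‖1 - v‖ ^ (τ - 1))) := by gcongr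
    _ = B * ((1 - ‖v‖) ^ (τ - 1) * ‖1 - v‖ ^ (τ - 1)) := by
        have : (1 - ‖v‖) ^ (τ - 1) = (1 - ‖v‖) ^ (p - 2 + t) * (1 - ‖v‖) ^ (-(p - 1 + τ)) := by
          rw [← Real.rpow_add hx]
          congr 1
          rw [hτ]
          ring
        rw [this, hB]
        ring

/-! ### Möbius change of variables for the logarithmic kernel. -/

lemma one_sub_conj_mul_ne_zero {b w : ℂ} (hb : b ∈ disc) (hw : w ∈ disc) :
    1 - (starRingEnd ℂ) b * w ≠ 0 :=
  norm_pos_iff.1 (norm_one_sub_conj_mul_pos (norm_lt_one_of_mem_disc hb).le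
    (norm_lt_one_of_mem_disc hw))

lemma mobius_mem_disc {b w : ℂ} (hb : b ∈ disc) (hw : w ∈ disc) : mobius b w ∈ disc := by
  have hb1 := norm_lt_one_of_mem_disc hb
  have hw1 := norm_lt_one_of_mem_disc hw
  have h := one_sub_norm_mobius_sq (norm_one_sub_conj_mul_pos hb1.le hw1)
  have h2 : 0 < 1 - ‖mobius b w‖ ^ 2 := by
    rw [h]
    have := norm_one_sub_conj_mul_pos hb1.le hw1
    have : 0 < 1 - ‖b‖ ^ 2 := by nlinarith [norm_nonneg b]
    have : 0 < 1 - ‖w‖ ^ 2 := by nlinarith [norm_nonneg w]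
    positivity
  rw [mem_ball_zero_iff]
  nlinarith [norm_nonneg (mobius b w)]

lemma mobius_mobius {b w : ℂ} (hb : b ∈ disc) (hw : w ∈ disc) : mobius b (mobius b w) = w := by
  have h1 := one_sub_conj_mul_ne_zero hb hw
  have h2 := one_sub_conj_mul_ne_zero hb hb
  have h3 := one_sub_conj_mul_ne_zero hb (mobius_mem_disc hb hw)
  rw [mobius, div_eq_iff h3]
  have e : mobius b w * (1 - (starRingEnd ℂ) b * w) = b - w := div_mul_cancel₀ _ h1
  linear_combination -e

lemma hasDerivAt_mobius {b w : ℂ} (hb : b ∈ disc) (hw : w ∈ disc) :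
    HasDerivAt (mobius b) (-((1 - (starRingEnd ℂ) b * b) / (1 - (starRingEnd ℂ) b * w) ^ 2)) w := by
  have h1 := one_sub_conj_mul_ne_zero hb hw
  have h2 : HasDerivAt (fun z => b - z) (-1) w := (hasDerivAt_id w).const_sub b
  have h3 : HasDerivAt (fun z => 1 - (starRingEnd ℂ) b * z) (-((starRingEnd ℂ) b)) w := by
    simpa using ((hasDerivAt_id w).const_mul ((starRingEnd ℂ) b)).const_sub 1
  have h4 := h2.div h3 h1
  convert! h4 using 1
  rw [← neg_div]
  congr 1
  ring

lemma det_restrictScalars_toSpanSingleton (c : ℂ) :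
    ((ContinuousLinearMap.toSpanSingleton ℂ c).restrictScalars ℝ).det = ‖c‖ ^ 2 := by
  rw [ContinuousLinearMap.det, ContinuousLinearMap.coe_restrictScalars,
    LinearMap.det_restrictScalars, Algebra.norm_complex_apply, Complex.normSq_eq_norm_sq]
  congr 2
  simp

lemma one_sub_conj_mul_self (b : ℂ) : 1 - (starRingEnd ℂ) b * b = ((1 - ‖b‖ ^ 2 : ℝ) : ℂ) := by
  rw [Complex.conj_mul']
  push_cast
  ring

/-- The modulus of the derivative of `mobius b` at `w`. -/
def mobiusJac (b w : ℂ) : ℝ := (1 - ‖b‖ ^ 2) / ‖1 - (starRingEnd ℂ) b * w‖ ^ 2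

lemma lintegral_comp_mobius {b : ℂ} (hb : b ∈ disc) (F : ℂ → ℝ≥0∞) :
    ∫⁻ z in disc, F z = ∫⁻ w in disc, ENNReal.ofReal (mobiusJac b w ^ 2) * F (mobius b w) := by
  have himg : mobius b '' disc = disc := by
    ext z
    constructor
    · rintro ⟨w, hw, rfl⟩
      exact mobius_mem_disc hb hw
    · exact fun hz => ⟨mobius b z, mobius_mem_disc hb hz, mobius_mobius hb hz⟩
  have hinj : InjOn (mobius b) disc := fun x hx y hy hxy => by
    rw [← mobius_mobius hb hx, hxy, mobius_mobius hb hy]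
  have h := lintegral_image_eq_lintegral_abs_det_fderiv_mul volume measurableSet_ball
    (fun w hw => ((hasDerivAt_mobius hb hw).hasFDerivAt.restrictScalars ℝ).hasFDerivWithinAt)
    hinj F
  rw [himg] at h
  rw [h]
  refine setLIntegral_congr_fun measurableSet_ball fun w hw => ?_
  have hb1 := norm_lt_one_of_mem_disc hb
  simp only [det_restrictScalars_toSpanSingleton]
  rw [abs_of_nonneg (by positivity), norm_neg, norm_div, norm_pow, one_sub_conj_mul_self,
    Complex.norm_real, Real.norm_of_nonneg (by nlinarith [norm_nonneg b])]
  rfl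

/-- Up to a constant, $\log(1-\bar a\varphi_b(w))$ is $\log(1-\bar cw)-\log(1-\bar bw)$ with
$c=\varphi_b(a)$. Differentiating gives `hid`, so the composed kernel is a difference of two kernels
of the same type. -/
lemma norm_mul_mobiusJac_div_le {a b w : ℂ} (ha : a ∈ disc) (hb : b ∈ disc) (hw : w ∈ disc) :
    mobiusJac b w * (‖a‖ / ‖1 - (starRingEnd ℂ) a * mobius b w‖) ≤
      1 / ‖1 - (starRingEnd ℂ) (mobius b a) * w‖ + 1 / ‖1 - (starRingEnd ℂ) b * w‖ := by
  have hb1 := norm_lt_one_of_mem_disc hb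
  have hab := one_sub_conj_mul_ne_zero hb ha
  have hab' := one_sub_conj_mul_ne_zero ha hb
  have hcm : mobius b a ∈ disc := mobius_mem_disc hb ha
  have hbw := one_sub_conj_mul_ne_zero hb hw
  have hcw := one_sub_conj_mul_ne_zero hcm hw
  have ham := one_sub_conj_mul_ne_zero ha (mobius_mem_disc hb hw)
  have hm : mobius b w * (1 - (starRingEnd ℂ) b * w) = b - w := div_mul_cancel₀ _ hbw
  have hcc : (starRingEnd ℂ) (mobius b a) * (1 - (starRingEnd ℂ) a * b) =
      (starRingEnd ℂ) b - (starRingEnd ℂ) a := by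
    have : 1 - (starRingEnd ℂ) a * b = (starRingEnd ℂ) (1 - (starRingEnd ℂ) b * a) := by
      simp [mul_comm]
    rw [this, ← map_mul, mobius, div_mul_cancel₀ _ hab, map_sub]
  set β := (starRingEnd ℂ) b
  set α := (starRingEnd ℂ) a
  set γ := (starRingEnd ℂ) (mobius b a)
  set m := mobius b w
  have hE : (1 - β * w) * (1 - α * m) = (1 - α * b) * (1 - γ * w) := by
    linear_combination (-α) * hm + w * hcc
  have hid : (1 - β * b) / (1 - β * w) ^ 2 * (α / (1 - α * m)) =
      β / (1 - β * w) - γ / (1 - γ * w) := by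
    have h1 : α / (1 - α * m) = α * (1 - β * w) / ((1 - α * b) * (1 - γ * w)) := by
      rw [← hE, mul_comm α (1 - β * w), mul_div_mul_left _ _ hbw]
    have h2 : γ / (1 - γ * w) = (β - α) / ((1 - α * b) * (1 - γ * w)) := by
      rw [← hcc, mul_comm γ (1 - α * b), mul_div_mul_left _ _ hab']
    have h3 : (1 - α * b) * (1 - γ * w) = (1 - α * b) - (β - α) * w := by
      linear_combination (-w) * hcc
    have h4 : (1 - α * b) * (1 - γ * w) ≠ 0 := mul_ne_zero hab' hcw
    rw [h1, h2, div_mul_div_comm, div_sub_div _ _ hbw h4, div_eq_div_iff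
      (mul_ne_zero (pow_ne_zero 2 hbw) h4) (mul_ne_zero hbw h4), h3]
    ring
  have hJ : mobiusJac b w * (‖a‖ / ‖1 - α * m‖) =
      ‖(1 - β * b) / (1 - β * w) ^ 2 * (α / (1 - α * m))‖ := by
    rw [norm_mul, norm_div, norm_div, norm_pow, one_sub_conj_mul_self, Complex.norm_real,
      Real.norm_of_nonneg (by nlinarith [norm_nonneg b]), RCLike.norm_conj]
    rfl
  have hβ : ‖β‖ ≤ 1 := by rw [RCLike.norm_conj]; exact hb1.le
  have hγ : ‖γ‖ ≤ 1 := by rw [RCLike.norm_conj]; exact (norm_lt_one_of_mem_disc hcm).le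
  rw [hJ, hid, add_comm]
  refine (norm_sub_le _ _).trans ?_
  rw [norm_div, norm_div]
  gcongr

/-- The Möbius invariant integrals of the functions with `|f'(z)| ≤ |a| / |1 - conj a * z|` are
uniformly bounded. -/
lemma exists_lintegral_log_kernel_le {p t : ℝ} (hp : 1 < p) (ht : 0 < t) (ht1 : t ≤ 1) :
    ∃ C : ℝ≥0∞, C ≠ ∞ ∧ ∀ a ∈ disc, ∀ b ∈ disc, ∫⁻ z in disc,
      ENNReal.ofReal (‖a‖ / ‖1 - (starRingEnd ℂ) a * z‖) ^ p *
        ENNReal.ofReal ((1 - ‖z‖ ^ 2) ^ (p - 2) * (1 - ‖mobius b z‖ ^ 2) ^ t) ≤ C := by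
  have hp0 : 0 < p := by linarith
  obtain ⟨C, hCt, hC⟩ := exists_lintegral_kernel_le hp ht ht1
  refine ⟨2 ^ (p - 1) * (C + C), ENNReal.mul_ne_top
    (ENNReal.rpow_ne_top_of_nonneg (by linarith) (by simp)) (ENNReal.add_ne_top.2 ⟨hCt, hCt⟩),
    fun a ha b hb => ?_⟩
  have hb1 := norm_lt_one_of_mem_disc hb
  have hb2 : 0 < 1 - ‖b‖ ^ 2 := by nlinarith [norm_nonneg b]
  have hkey : ∀ w ∈ disc, ENNReal.ofReal (mobiusJac b w ^ 2) *
      (ENNReal.ofReal (‖a‖ / ‖1 - (starRingEnd ℂ) a * mobius b w‖) ^ p *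
        ENNReal.ofReal ((1 - ‖mobius b w‖ ^ 2) ^ (p - 2) *
          (1 - ‖mobius b (mobius b w)‖ ^ 2) ^ t)) ≤
      2 ^ (p - 1) * (ENNReal.ofReal ((1 - ‖w‖ ^ 2) ^ (p - 2 + t) *
        (1 / ‖1 - (starRingEnd ℂ) (mobius b a) * w‖) ^ p) +
        ENNReal.ofReal ((1 - ‖w‖ ^ 2) ^ (p - 2 + t) * (1 / ‖1 - (starRingEnd ℂ) b * w‖) ^ p)) := by
    intro w hw
    have hw1 := norm_lt_one_of_mem_disc hw
    have hw2 : 0 < 1 - ‖w‖ ^ 2 := by nlinarith [norm_nonneg w]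
    have hbw := norm_one_sub_conj_mul_pos hb1.le hw1
    have hJ0 : 0 < mobiusJac b w := by unfold mobiusJac; positivity
    have hm : 1 - ‖mobius b w‖ ^ 2 = mobiusJac b w * (1 - ‖w‖ ^ 2) := by
      rw [one_sub_norm_mobius_sq hbw, mobiusJac]
      ring
    rw [mobius_mobius hb hw, hm]
    set J := mobiusJac b w
    set X := ‖a‖ / ‖1 - (starRingEnd ℂ) a * mobius b w‖
    have hX0 : 0 ≤ X := by positivity
    set u := 1 / ‖1 - (starRingEnd ℂ) (mobius b a) * w‖
    set v := 1 / ‖1 - (starRingEnd ℂ) b * w‖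
    have hu0 : 0 ≤ u := by positivity
    have hv0 : 0 ≤ v := by positivity
    have hle : J * X ≤ u + v := norm_mul_mobiusJac_div_le ha hb hw
    -- The Jacobian $J^2$ and the factor $J^{p-2}$ from the weight combine to $J^p$, which joins
    -- $X^p$.
    have e1 : ENNReal.ofReal (J ^ 2) * (ENNReal.ofReal X ^ p * ENNReal.ofReal
        ((J * (1 - ‖w‖ ^ 2)) ^ (p - 2) * (1 - ‖w‖ ^ 2) ^ t)) =
        ENNReal.ofReal ((1 - ‖w‖ ^ 2) ^ (p - 2 + t)) * ENNReal.ofReal (J * X) ^ p := by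
      rw [ENNReal.ofReal_rpow_of_nonneg hX0 hp0.le, ENNReal.ofReal_rpow_of_nonneg
        (by positivity) hp0.le, ← ENNReal.ofReal_mul (by positivity),
        ← ENNReal.ofReal_mul (by positivity), ← ENNReal.ofReal_mul (by positivity)]
      congr 1
      have hJp : J ^ p = J ^ 2 * J ^ (p - 2) := by
        rw [← Real.rpow_two, ← Real.rpow_add hJ0]
        congr 1
        ring
      rw [Real.mul_rpow hJ0.le hw2.le, Real.mul_rpow hJ0.le hX0, Real.rpow_add hw2, hJp]
      ring
    rw [e1, ENNReal.ofReal_mul (q := u ^ p) (by positivity),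
      ENNReal.ofReal_mul (q := v ^ p) (by positivity), ← mul_add,
      mul_left_comm]
    gcongr
    rw [← ENNReal.ofReal_rpow_of_nonneg hu0 hp0.le, ← ENNReal.ofReal_rpow_of_nonneg hv0 hp0.le]
    calc ENNReal.ofReal (J * X) ^ p ≤ (ENNReal.ofReal u + ENNReal.ofReal v) ^ p := by
          rw [← ENNReal.ofReal_add hu0 hv0]
          gcongr
      _ ≤ _ := ENNReal.rpow_add_le_mul_rpow_add_rpow _ _ hp.le
  rw [lintegral_comp_mobius hb]
  refine (setLIntegral_mono' measurableSet_ball hkey).trans ?_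
  rw [lintegral_const_mul' _ _ (ENNReal.rpow_ne_top_of_nonneg (by linarith) (by simp)),
    lintegral_add_left (by fun_prop)]
  gcongr
  · exact hC _ (mobius_mem_disc hb ha)
  · exact hC _ hb

/-! ### Logarithmic test functions and necessity. -/

/-- The function `(4 - log (1 - conj a * z))^2 / (4 - log (1 - |a|))`, which is of size
`log (2 / (1 - |a|))` near `a`. -/
def logTest (a z : ℂ) : ℂ :=
  (4 - Complex.log (1 - (starRingEnd ℂ) a * z)) ^ 2 / ((4 - Real.log (1 - ‖a‖) : ℝ) : ℂ)

lemma re_one_sub_conj_mul_pos {a z : ℂ} (ha : a ∈ disc) (hz : z ∈ disc) :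
    0 < (1 - (starRingEnd ℂ) a * z).re := by
  have ha1 := norm_lt_one_of_mem_disc ha
  have hz1 := norm_lt_one_of_mem_disc hz
  have h1 := Complex.re_le_norm ((starRingEnd ℂ) a * z)
  rw [norm_mul, RCLike.norm_conj] at h1
  rw [Complex.sub_re, Complex.one_re]
  nlinarith [norm_nonneg a, norm_nonneg z]

lemma log_one_sub_norm_nonpos {a : ℂ} (ha : a ∈ disc) : Real.log (1 - ‖a‖) ≤ 0 :=
  Real.log_nonpos (by linarith [norm_lt_one_of_mem_disc ha]) (by linarith [norm_nonneg a])

lemma hasDerivAt_logTest {a z : ℂ} (ha : a ∈ disc) (hz : z ∈ disc) :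
    HasDerivAt (logTest a) (2 * (4 - Complex.log (1 - (starRingEnd ℂ) a * z)) *
      ((starRingEnd ℂ) a / (1 - (starRingEnd ℂ) a * z)) /
        ((4 - Real.log (1 - ‖a‖) : ℝ) : ℂ)) z := by
  have h1 : HasDerivAt (fun z => 1 - (starRingEnd ℂ) a * z) (-(starRingEnd ℂ) a) z := by
    simpa using ((hasDerivAt_id z).const_mul ((starRingEnd ℂ) a)).const_sub 1
  have h2 := h1.clog (Or.inl (re_one_sub_conj_mul_pos ha hz))
  have h3 := ((h2.const_sub 4).pow 2).div_const ((4 - Real.log (1 - ‖a‖) : ℝ) : ℂ)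
  convert! h3 using 1
  rw [neg_div, neg_neg]
  norm_num

lemma differentiableOn_logTest {a : ℂ} (ha : a ∈ disc) : DifferentiableOn ℂ (logTest a) disc :=
  fun _ hz => (hasDerivAt_logTest ha hz).differentiableAt.differentiableWithinAt

/-- The imaginary part is at most $\pi/2$, since $\operatorname{Re}\xi>0$, and is absorbed by the
constant $4$. It is used with $x=1-|a|$ for the norm bound and with $x=1-|z|$ for pointwise decay.
-/
lemma norm_four_sub_log_le {ξ : ℂ} {x : ℝ} (hξ : ‖ξ‖ ≤ 2) (hx : 0 < x) (hxξ : x ≤ ‖ξ‖)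
    (hx1 : x ≤ 1) (hre : 0 < ξ.re) : ‖4 - Complex.log ξ‖ ≤ 3 * (4 - Real.log x) := by
  have h1 : Real.log x ≤ Real.log ‖ξ‖ := Real.log_le_log hx hxξ
  have h2 : Real.log ‖ξ‖ ≤ Real.log 2 := Real.log_le_log (hx.trans_le hxξ) hξ
  have h3 : |ξ.arg| ≤ Real.pi / 2 := (Complex.abs_arg_lt_pi_div_two_iff.2 (Or.inl hre)).le
  have h4 := Complex.norm_le_abs_re_add_abs_im (4 - Complex.log ξ)
  have h5 : (4 - Complex.log ξ).re = 4 - Real.log ‖ξ‖ := by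
    rw [Complex.sub_re, Complex.log_re]
    norm_num
  have h6 : (4 - Complex.log ξ).im = -ξ.arg := by
    rw [Complex.sub_im, Complex.log_im]
    norm_num
  have h7 : Real.log x ≤ 0 := Real.log_nonpos hx.le hx1
  have h8 := Real.log_two_lt_d9
  rw [h5, h6, abs_neg, abs_of_nonneg (by linarith)] at h4
  linarith [Real.pi_lt_d2]

lemma norm_one_sub_conj_mul_le_two {a z : ℂ} (ha : a ∈ disc) (hz : z ∈ disc) :
    ‖1 - (starRingEnd ℂ) a * z‖ ≤ 2 := by
  have ha1 := norm_lt_one_of_mem_disc ha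
  have hz1 := norm_lt_one_of_mem_disc hz
  refine (norm_sub_le _ _).trans ?_
  rw [norm_one, norm_mul, RCLike.norm_conj]
  nlinarith [norm_nonneg a, norm_nonneg z]

lemma exists_fNorm_logTest_le {p t : ℝ} (hp : 1 < p) (ht : 0 < t) (ht1 : t ≤ 1) :
    ∃ M : ℝ≥0∞, M < ∞ ∧ ∀ a ∈ disc, fNorm p (p - 2) t (logTest a) ≤ M := by
  have hp0 : 0 < p := by linarith
  obtain ⟨C, hCt, hC⟩ := exists_lintegral_log_kernel_le hp ht ht1
  have h6 : (6 : ℝ≥0∞) ^ p ≠ ∞ := ENNReal.rpow_ne_top_of_nonneg hp0.le (by simp)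
  refine ⟨4 + (6 ^ p * C) ^ (1 / p), ?_, fun a ha => ?_⟩
  · exact ENNReal.add_lt_top.2 ⟨by simp, ENNReal.rpow_lt_top_of_nonneg (by positivity)
      (ENNReal.mul_ne_top h6 hCt)⟩
  have ha1 := norm_lt_one_of_mem_disc ha
  have hlog := log_one_sub_norm_nonpos ha
  set L : ℝ := 4 - Real.log (1 - ‖a‖) with hL
  have hL4 : 4 ≤ L := by linarith
  refine add_le_add ?_ (iSup₂_le fun b hb => ENNReal.rpow_le_rpow ?_ (by positivity))
  · have : ‖logTest a 0‖ ≤ 4 := by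
      simp only [logTest, mul_zero, sub_zero, Complex.log_one, norm_div, norm_pow,
        Complex.norm_real]
      rw [Real.norm_of_nonneg (by linarith), div_le_iff₀ (by linarith)]
      norm_num
      linarith
    rw [← ofReal_norm]
    exact (ENNReal.ofReal_le_ofReal this).trans (by simp)
  · refine le_trans ?_ (mul_le_mul_right (hC a ha b hb) _)
    rw [← lintegral_const_mul' _ _ h6]
    refine setLIntegral_mono' measurableSet_ball fun z hz => ?_
    have hz1 := norm_lt_one_of_mem_disc hz
    have hΛ := norm_four_sub_log_le (norm_one_sub_conj_mul_le_two ha hz)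
      (by linarith : 0 < 1 - ‖a‖) (one_sub_norm_le_norm_one_sub_conj_mul' hz1.le)
      (by linarith [norm_nonneg a]) (re_one_sub_conj_mul_pos ha hz)
    have hd : ‖deriv (logTest a) z‖ ≤ 6 * (‖a‖ / ‖1 - (starRingEnd ℂ) a * z‖) := by
      rw [(hasDerivAt_logTest ha hz).deriv, norm_div, norm_mul, norm_mul, norm_div,
        RCLike.norm_conj, Complex.norm_real, Real.norm_of_nonneg (by linarith),
        div_le_iff₀ (by linarith)]
      have h2 : ‖(2 : ℂ)‖ = 2 := by simp
      rw [h2]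
      calc 2 * ‖4 - Complex.log (1 - (starRingEnd ℂ) a * z)‖ *
            (‖a‖ / ‖1 - (starRingEnd ℂ) a * z‖)
          ≤ 2 * (3 * L) * (‖a‖ / ‖1 - (starRingEnd ℂ) a * z‖) := by gcongr
        _ = _ := by ring
    rw [← mul_assoc, ← ENNReal.mul_rpow_of_nonneg _ _ hp0.le]
    gcongr
    rw [← ofReal_norm, ← ENNReal.ofReal_ofNat 6, ← ENNReal.ofReal_mul (by norm_num)]
    exact ENNReal.ofReal_le_ofReal hd

lemma tendsto_logTest_zero {a : ℕ → ℂ} (ha : ∀ n, a n ∈ disc)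
    (hlim : Tendsto (fun n => 1 - ‖a n‖) atTop (𝓝[>] 0)) {z : ℂ} (hz : z ∈ disc) :
    Tendsto (fun n => logTest (a n) z) atTop (𝓝 0) := by
  have hz1 := norm_lt_one_of_mem_disc hz
  have h1 : Tendsto (fun n => 4 - Real.log (1 - ‖a n‖)) atTop atTop := by
    have := (tendsto_neg_atBot_atTop.comp (Real.tendsto_log_nhdsGT_zero.comp hlim))
    refine (tendsto_atTop_add_const_left _ 4 this).congr fun n => ?_
    simp only [Function.comp_apply]
    ring
  have h2 : Tendsto (fun n => (3 * (4 - Real.log (1 - ‖z‖))) ^ 2 / (4 - Real.log (1 - ‖a n‖)))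
      atTop (𝓝 0) := h1.const_div_atTop _
  refine squeeze_zero_norm (fun n => ?_) h2
  have hlog := log_one_sub_norm_nonpos (ha n)
  rw [logTest, norm_div, norm_pow, Complex.norm_real, Real.norm_of_nonneg (by linarith)]
  have := norm_four_sub_log_le (norm_one_sub_conj_mul_le_two (ha n) hz)
      (by linarith : 0 < 1 - ‖z‖)
      (one_sub_norm_le_norm_one_sub_conj_mul (norm_lt_one_of_mem_disc (ha n)).le z)
      (by linarith [norm_nonneg z]) (re_one_sub_conj_mul_pos (ha n) hz)
  have : 0 ≤ 4 - Real.log (1 - ‖a n‖) := by linarith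
  gcongr

lemma norm_one_sub_conj_mul_le_of_mem_tent {θ h : ℝ} (hh : h ∈ Ioc (0 : ℝ) 1) {z : disc}
    (hz : z ∈ tent θ h) :
    ‖1 - (starRingEnd ℂ) ((1 - h : ℝ) * Complex.exp (θ * Complex.I)) * z‖ ≤ 6 * h := by
  apply norm_one_sub_conj_mul_le_of_near hh
  have hz0 := ne_zero_of_mem_tent hh.2 hz
  have h1 := norm_sub_exp_le_of_mem_arc hz.2
  have hz1 := norm_lt_one_of_mem_disc z.2
  have hh1 := hz.1
  set ζ : ℂ := (z : ℂ) / (‖(z : ℂ)‖ : ℂ) with hζ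
  have hζ1 : ‖ζ‖ = 1 := norm_div_norm_of_ne_zero hz0
  have h2 : ‖ζ - z‖ = 1 - ‖(z : ℂ)‖ := by
    have : ζ - z = ((1 - ‖(z : ℂ)‖ : ℝ) : ℂ) * ζ := by
      have : (z : ℂ) = (‖(z : ℂ)‖ : ℂ) * ζ := by
        rw [hζ, mul_div_cancel₀]
        exact_mod_cast norm_ne_zero_iff.2 hz0
      conv_lhs => rw [this]
      push_cast
      ring
    rw [this, norm_mul, hζ1, mul_one, Complex.norm_real, Real.norm_of_nonneg (by linarith)]
  have h3 := norm_sub_le_norm_sub_add_norm_sub (Complex.exp (θ * Complex.I)) ζ z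
  rw [norm_sub_rev _ ζ] at h3
  nlinarith [Real.pi_lt_d2, hh.1]

lemma log_le_norm_logTest {θ h : ℝ} (hh : h ∈ Ioc (0 : ℝ) 1) {z : disc} (hz : z ∈ tent θ h) :
    Real.log (2 / h) / 4 ≤ ‖logTest ((1 - h : ℝ) * Complex.exp (θ * Complex.I)) z‖ := by
  have h0 := hh.1
  have hn := norm_ofReal_mul_exp (1 - h) θ (by linarith [hh.2])
  have h6 := norm_one_sub_conj_mul_le_of_mem_tent hh hz
  set a := ((1 - h : ℝ) : ℂ) * Complex.exp (θ * Complex.I) with ha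
  have hpos : 0 < ‖1 - (starRingEnd ℂ) a * z‖ :=
    norm_one_sub_conj_mul_pos (by rw [hn]; linarith) (norm_lt_one_of_mem_disc z.2)
  have hl2 := Real.log_two_lt_d9
  set x := -Real.log h with hx
  have hx0 : 0 ≤ x := by
    have := Real.log_nonpos h0.le hh.2
    linarith
  -- On the tent $|1-\bar az|\le6h\le2^3h$, and $3\log2<3$ leaves at least $1+x$ of $4-\log|1-\bar
  -- az|$.
  have hre : 1 + x ≤ ‖4 - Complex.log (1 - (starRingEnd ℂ) a * z)‖ := by
    refine le_trans ?_ (Complex.re_le_norm _)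
    have h5 : (4 - Complex.log (1 - (starRingEnd ℂ) a * z)).re =
        4 - Real.log ‖1 - (starRingEnd ℂ) a * z‖ := by
      rw [Complex.sub_re, Complex.log_re]
      norm_num
    have h7 : Real.log ‖1 - (starRingEnd ℂ) a * z‖ ≤ Real.log (2 ^ 3 * h) :=
      Real.log_le_log hpos (by linarith)
    rw [Real.log_mul (by norm_num) h0.ne', Real.log_pow] at h7
    rw [h5]
    push_cast at h7
    linarith
  have hlog : Real.log (2 / h) = Real.log 2 + x := by
    rw [Real.log_div (by norm_num) h0.ne', hx]
    ring
  rw [logTest, norm_div, norm_pow, Complex.norm_real, hn, sub_sub_cancel,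
    Real.norm_of_nonneg (by linarith), le_div_iff₀ (by linarith), hlog]
  have h8 : (1 + x) ^ 2 ≤ ‖4 - Complex.log (1 - (starRingEnd ℂ) a * z)‖ ^ 2 := by gcongr
  have : 4 - Real.log h = 4 + x := by rw [hx]; ring
  rw [this]
  nlinarith

/-- If `F(p, p - 2, t)` embeds compactly into the tent space, then `μ` is a vanishing
`s`-Carleson measure. -/
theorem isVanishingCarleson_of_isCompactId {p t s : ℝ} (hp : 1 < p) (ht : 0 < t) (ht1 : t ≤ 1)
    {μ : Measure disc} (hc : IsCompactId (fNorm p (p - 2) t) (tentNorm p s μ)) :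
    IsVanishingCarleson s μ := by
  have hp0 : 0 < p := by linarith
  by_contra hcon
  rw [IsVanishingCarleson, ENNReal.tendsto_nhds_zero] at hcon
  push Not at hcon
  obtain ⟨ε, hε, hfreq⟩ := hcon
  have hex : ∀ n : ℕ, ∃ h ∈ Ioo (0 : ℝ) (1 / ((n : ℝ) + 1)), ∃ θ : ℝ,
      ε < μ (tent θ h) / ENNReal.ofReal (h ^ s) := by
    intro n
    have hev : ∀ᶠ h in 𝓝[>] (0 : ℝ), h ∈ Ioo (0 : ℝ) (1 / ((n : ℝ) + 1)) :=
      Ioo_mem_nhdsGT (by positivity)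
    obtain ⟨h, h1, h2⟩ := (hfreq.and_eventually hev).exists
    exact ⟨h, h2, lt_iSup_iff.1 h1⟩
  choose h hh θ hlt using hex
  have hh1 : ∀ n, h n < 1 := fun n => (hh n).2.trans_le
    ((div_le_one (by positivity)).2 (by linarith [(Nat.cast_nonneg n : (0 : ℝ) ≤ n)]))
  have hhI : ∀ n, h n ∈ Ioc (0 : ℝ) 1 := fun n => ⟨(hh n).1, (hh1 n).le⟩
  set a : ℕ → ℂ := fun n => ((1 - h n : ℝ) : ℂ) * Complex.exp (θ n * Complex.I) with ha
  have han : ∀ n, ‖a n‖ = 1 - h n := fun n =>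
    norm_ofReal_mul_exp (1 - h n) (θ n) (by linarith [hh1 n])
  have had : ∀ n, a n ∈ disc := fun n => by
    rw [mem_ball_zero_iff, han]
    linarith [(hh n).1]
  have hlim : Tendsto (fun n => 1 - ‖a n‖) atTop (𝓝[>] 0) := by
    simp only [han, sub_sub_cancel]
    refine tendsto_nhdsWithin_iff.2 ⟨?_, Eventually.of_forall fun n => (hh n).1⟩
    exact squeeze_zero (fun n => (hh n).1.le) (fun n => (hh n).2.le)
      tendsto_one_div_add_atTop_nhds_zero_nat
  obtain ⟨M, hMt, hM⟩ := exists_fNorm_logTest_le hp ht ht1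
  obtain ⟨g, hg, k, hk, hconv⟩ := hc.2 (fun n => logTest (a n))
    (fun n => ⟨differentiableOn_logTest (had n), (hM _ (had n)).trans_lt hMt⟩)
    ⟨M, hMt, fun n => hM _ (had n)⟩
  have hmeas : ∀ F : ℂ → ℂ, DifferentiableOn ℂ F disc → Measurable fun z : disc => F z := by
    intro F hF
    have : Continuous fun z : disc => F z :=
      continuousOn_iff_continuous_domRestrict.1 hF.continuousOn
    exact this.measurable
  have hconvp : Tendsto (fun n => tentNorm p s μ (logTest (a (k n)) - g) ^ p) atTop (𝓝 0) := by
    have := hconv.ennrpow_const p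
    rwa [ENNReal.zero_rpow_of_pos hp0] at this
  have hone : (1 : ℝ) ∈ Ioc (0 : ℝ) 1 := ⟨one_pos, le_rfl⟩
  -- The limit `g` is not known in advance. The test functions vanish pointwise in the limit, so
  -- Fatou on the punctured disc shows $g=0$ $\mu$-almost everywhere there.
  have hg0 : ∫⁻ z in tent 0 1, ‖g (z : ℂ)‖ₑ ^ p ∂μ = 0 := by
    refine le_antisymm ?_ zero_le
    calc ∫⁻ z in tent 0 1, ‖g (z : ℂ)‖ₑ ^ p ∂μ
        = ∫⁻ z in tent 0 1, liminf (fun n => ‖(logTest (a (k n)) - g) (z : ℂ)‖ₑ ^ p) atTop ∂μ := by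
          refine lintegral_congr fun z => ?_
          refine (Tendsto.liminf_eq ?_).symm
          have h1 := (tendsto_logTest_zero had hlim z.2).comp hk.tendsto_atTop
          have h2 := ((h1.sub_const (g z)).enorm).ennrpow_const p
          simpa using h2
      _ ≤ liminf (fun n => ∫⁻ z in tent 0 1, ‖(logTest (a (k n)) - g) (z : ℂ)‖ₑ ^ p ∂μ) atTop :=
          lintegral_liminf_le fun n =>
            (hmeas _ ((differentiableOn_logTest (had _)).sub hg.1)).enorm.pow_const p
      _ ≤ liminf (fun n => tentNorm p s μ (logTest (a (k n)) - g) ^ p *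
            ENNReal.ofReal (1 ^ s * Real.log (2 / 1) ^ p)) atTop :=
          liminf_le_liminf (Eventually.of_forall fun n =>
            lintegral_tent_le_tentNorm hp0 μ _ 0 hone)
      _ = 0 := by
          refine Tendsto.liminf_eq ?_
          have := ENNReal.Tendsto.mul_const (b := ENNReal.ofReal (1 ^ s * Real.log (2 / 1) ^ p))
            hconvp (Or.inr ENNReal.ofReal_ne_top)
          simpa using this
  have hgae : ∀ᵐ z : disc ∂(μ.restrict (tent 0 1)), ‖g (z : ℂ)‖ₑ ^ p = 0 :=
    (lintegral_eq_zero_iff ((hmeas g hg.1).enorm.pow_const p)).1 hg0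
  -- As $g=0$ almost everywhere, the difference is at least $L/4$ on the tent; the $L^p$ in the norm
  -- cancels, leaving $4^p$.
  have hbound : ∀ n, μ (tent (θ (k n)) (h (k n))) / ENNReal.ofReal (h (k n) ^ s) ≤
      4 ^ p * tentNorm p s μ (logTest (a (k n)) - g) ^ p := by
    intro n
    set N := tentNorm p s μ (logTest (a (k n)) - g)
    have hhn := hhI (k n)
    set h' := h (k n)
    have hpos : 0 < h' := hhn.1
    set L := Real.log (2 / h') with hL
    have hL0 : 0 < L := by
      apply Real.log_pos
      rw [lt_div_iff₀ hpos]
      linarith [hhn.2]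
    have hsub : tent (θ (k n)) h' ⊆ tent 0 1 := fun z hz =>
      mem_tent_one (ne_zero_of_mem_tent hhn.2 hz)
    have hgae' := ae_restrict_of_ae_restrict_of_subset hsub hgae
    have h1 : ENNReal.ofReal ((L / 4) ^ p) * μ (tent (θ (k n)) h') ≤
        N ^ p * ENNReal.ofReal (h' ^ s * L ^ p) := by
      refine le_trans ?_ (lintegral_tent_le_tentNorm hp0 μ (logTest (a (k n)) - g) (θ (k n)) hhn)
      rw [← Measure.restrict_apply_univ (tent (θ (k n)) h'), ← lintegral_const]
      refine lintegral_mono_ae ?_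
      filter_upwards [hgae', ae_restrict_mem (measurableSet_tent _ _)] with z hz0 hz
      have hgz : g z = 0 := by
        rcases ENNReal.rpow_eq_zero_iff.1 hz0 with h2 | h2
        · simpa using h2.1
        · linarith [h2.2]
      rw [Pi.sub_apply, hgz, sub_zero, ← ENNReal.ofReal_rpow_of_pos (by positivity)]
      gcongr
      rw [← ofReal_norm]
      exact ENNReal.ofReal_le_ofReal (log_le_norm_logTest hhn hz)
    have hhs : 0 < h' ^ s := Real.rpow_pos_of_pos hpos _
    rw [ENNReal.div_le_iff (by simpa using hhs) ENNReal.ofReal_ne_top]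
    have h4 : ENNReal.ofReal ((4 / L) ^ p) * ENNReal.ofReal ((L / 4) ^ p) = 1 := by
      rw [← ENNReal.ofReal_mul (by positivity), ← Real.mul_rpow (by positivity) (by positivity),
        show 4 / L * (L / 4) = 1 by field_simp, Real.one_rpow, ENNReal.ofReal_one]
    calc μ (tent (θ (k n)) h')
        = ENNReal.ofReal ((4 / L) ^ p) *
            (ENNReal.ofReal ((L / 4) ^ p) * μ (tent (θ (k n)) h')) := by
          rw [← mul_assoc, h4, one_mul]
      _ ≤ ENNReal.ofReal ((4 / L) ^ p) * (N ^ p * ENNReal.ofReal (h' ^ s * L ^ p)) := by gcongr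
      _ = ENNReal.ofReal (4 ^ p * h' ^ s) * N ^ p := by
          rw [mul_left_comm, ← ENNReal.ofReal_mul (by positivity), mul_comm]
          congr 2
          rw [Real.div_rpow (by norm_num) hL0.le]
          field_simp
      _ = 4 ^ p * N ^ p * ENNReal.ofReal (h' ^ s) := by
          rw [ENNReal.ofReal_mul (by positivity), ← ENNReal.ofReal_rpow_of_pos (by norm_num),
            ENNReal.ofReal_ofNat]
          ring
  have hlim4 : Tendsto (fun n => 4 ^ p * tentNorm p s μ (logTest (a (k n)) - g) ^ p) atTop
      (𝓝 0) := by
    have := ENNReal.Tendsto.const_mul (a := 4 ^ p) hconvp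
      (Or.inr (ENNReal.rpow_ne_top_of_nonneg hp0.le (by simp)))
    simpa using this
  obtain ⟨n, hn⟩ := ((ENNReal.tendsto_nhds_zero.1 hlim4) ε hε).exists
  exact absurd ((hlt (k n)).trans_le ((hbound n).trans hn)) (lt_irrefl _)

/-- The exponent is kept as `2 - 2` so that the general case at $p=2$ applies verbatim. -/
lemma qNorm_eq_fNorm (t : ℝ) : qNorm t = fNorm 2 (2 - 2) t := by
  funext f
  simp only [qNorm, fNorm, sub_self, Real.rpow_zero, one_mul]

end CarlesonEmbedding

end

theorem mainTheorem4 (t s : ℝ) (ht : 0 < t) (hts : t < s) (hs : s ≤ 1)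
    (μ : Measure CarlesonEmbedding.disc) [IsLocallyFiniteMeasure μ] :
    (CarlesonEmbedding.IsCompactId (CarlesonEmbedding.qNorm t)
        (CarlesonEmbedding.tentNorm 2 s μ) ↔
      CarlesonEmbedding.IsVanishingCarleson s μ) ∧
    ∀ p : ℝ, 1 < p →
      (CarlesonEmbedding.IsCompactId (CarlesonEmbedding.fNorm p (p - 2) t)
          (CarlesonEmbedding.tentNorm p s μ) ↔
        CarlesonEmbedding.IsVanishingCarleson s μ) := by
  have h : ∀ p : ℝ, 1 < p → (CarlesonEmbedding.IsCompactId (CarlesonEmbedding.fNorm p (p - 2) t)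
      (CarlesonEmbedding.tentNorm p s μ) ↔ CarlesonEmbedding.IsVanishingCarleson s μ) :=
    fun p hp => ⟨CarlesonEmbedding.isVanishingCarleson_of_isCompactId hp ht (by linarith),
      CarlesonEmbedding.isCompactId_of_isVanishingCarleson hp ht hts hs⟩
  refine ⟨?_, h⟩
  rw [CarlesonEmbedding.qNorm_eq_fNorm]
  exact h 2 one_lt_two
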